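/- Let $H_1,G_1$ be (real or complex) Hilbert spaces and let $S_1\colon H_1\to G_1$ be a compact linear operator. Let $\lambda_1\ge\lambda_2\ge\dots\ge 0$ be the eigenvalues of $S_1^*S_1$ in non-increasing order, counted with multiplicity (filled up with zeros if there are only finitely many positive ones), assume $\lambda_2>0$, and let $m$ be the multiplicity of the eigenvalue $\lambda_1$. For $d\in\mathbb N=\{1,2,\dots\}$ let $S_d=S_1\otimes\dots\otimes S_1\colon H_d\to G_d$ be the $d$-fold tensor power of $S_1$ between the Hilbert space tensor powers $H_d=H_1\otimes\dots\otimes H_1$ and $G_d=G_1\otimes\dots\otimes G_1$; $S=(S_d)_{d\in\mathbb N}$ is the linear tensor product problem generated by $S_1$. For a bounded linear operator $T\colon F\to G$ and $n\in\mathbb N_0$ let $$e(n,T)=\inf_{A}\ \sup_{\|f\|\le 1}\|Tf-Af\|,$$ where $A$ runs over all linear algorithms $Af=\sum_{i=1}^n L_i(f)\,g_i$ with continuous linear functionals $L_i$ on $F$ and $g_i\in G$, and let $n^{\mathrm{abs}}(\varepsilon,T)=\min\{n\in\mathbb N_0 : e(n,T)\le\varepsilon\}$ be the information complexity for the absolute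 error criterion. All limits $\varepsilon^{-1}+d\to\infty$ below are taken over pairs $(\varepsilon,d)\in(0,1]\times\mathbb N$ with $\varepsilon<e(0,S_d)$. For $s,t>0$ the problem $S$ is called $(s,t)$-weakly tractable (absolute error criterion, worst case setting, arbitrary continuous linear functionals as information) if $$\lim_{\varepsilon^{-1}+d\to\infty}\frac{\ln n^{\mathrm{abs}}(\varepsilon,S_d)}{\varepsilon^{-s}+d^{\,t}}=0 .$$ **Theorem.** Let $s,t>0$. 1. If $\lambda_1<1$, then $S$ is $(s,t)$-weakly tractable if and only if $$\lim_{n\to\infty}\frac{\lambda_n}{(\ln n)^{-2/s}}=0. \qquad (*)$$ 2. If $\lambda_1=1$ and $m=1$, then $S$ is $(s,t)$-weakly tractable if and only if $(*)$ holds. 3. If $\lambda_1=1$ and $m>1$, then $S$ is $(s,t)$-weakly tractable if and only if $t>1$ and $(*)$ holds. 4. Let $\lambda_1>1$, put $S_1'=\lambda_1^{-1/2}S_1$ and $$M(\varepsilon,d)=\max_{\ell=1,\dots,d}\Big[\ell\cdot\ln n^{\mathrm{abs}}\big((\varepsilon/\lambda_1^{d/2})^{1/\ell},S_1'\big)\Big].$$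 If $S$ is $(s,t)$-weakly tractable, then $$t>1\quad\text{and}\quad \lim_{\varepsilon^{-1}+d\to\infty}\frac{M(\varepsilon,d)}{\varepsilon^{-s}+d^{\,t}}=0 .$$ Conversely, if $$t>1\quad\text{and}\quad \lim_{\varepsilon^{-1}+d\to\infty}\frac{\ln d\cdot M(\varepsilon,d)}{\varepsilon^{-s}+d^{\,t}}=0 ,$$ then $S$ is $(s,t)$-weakly tractable. -/

import Mathlib

open Filter Topology
open scoped TensorProduct

universe u v w

noncomputable section

/-! ### Worst case errors and information complexity -/

section Complexity

variable {𝕜 : Type u} [RCLike 𝕜]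
  {F : Type v} [NormedAddCommGroup F] [NormedSpace 𝕜 F]
  {G : Type w} [NormedAddCommGroup G] [NormedSpace 𝕜 G]

/-- The linear (deterministic, non-adaptive) algorithm `f ↦ ∑ i, L i f • g i`, which uses the
values of the `n` continuous linear functionals `L i` at the input `f`. -/
def linearAlgorithm {n : ℕ} (L : Fin n → (F →L[𝕜] 𝕜)) (g : Fin n → G) (f : F) : G :=
  ∑ i, L i f • g i

/-- The worst case error of an algorithm `A` for the solution operator `S`, over the closed unit
ball of the source space. -/
def worstCaseError (S : F →L[𝕜] G) (A : F → G) : ℝ :=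
  sSup ((fun f => ‖S f - A f‖) '' Metric.closedBall (0 : F) 1)

/-- The `n`-th minimal worst case error `e(n, S)`: the infimum of the worst case errors of all
linear algorithms which use `n` arbitrary continuous linear functionals. -/
def minimalError (S : F →L[𝕜] G) (n : ℕ) : ℝ :=
  ⨅ A : (Fin n → (F →L[𝕜] 𝕜)) × (Fin n → G), worstCaseError S (linearAlgorithm A.1 A.2)

/-- The information complexity for the absolute error criterion: the least `n` such that
`e(n, S) ≤ ε`. (Such an `n` exists when `0 < ε` and `S` is a compact operator between Hilbert
spaces.) -/
def absComplexity (ε : ℝ) (S : F →L[𝕜] G) : ℕ :=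
  sInf {n : ℕ | minimalError S n ≤ ε}

end Complexity

section Tractability

variable {𝕜 : Type u} [RCLike 𝕜]
  {F : ℕ → Type v} [∀ d, NormedAddCommGroup (F d)] [∀ d, NormedSpace 𝕜 (F d)]
  {G : ℕ → Type w} [∀ d, NormedAddCommGroup (G d)] [∀ d, NormedSpace 𝕜 (G d)]

/-- The filter along which the limit `ε⁻¹ + d → ∞` is taken for the absolute error criterion:
over the pairs `(ε, d)` with `0 < ε ≤ 1`, `1 ≤ d` and `ε < e(0, S d)`, the initial error in
dimension `d`. The operators `S d` with `1 ≤ d` form the problem; `S 0` is never used. -/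
def absLimit (S : ∀ d, F d →L[𝕜] G d) : Filter (ℝ × ℕ) :=
  comap (fun p : ℝ × ℕ => p.1⁻¹ + (p.2 : ℝ)) atTop ⊓
    𝓟 {p : ℝ × ℕ | 0 < p.1 ∧ p.1 ≤ 1 ∧ 1 ≤ p.2 ∧ p.1 < minimalError (S p.2) 0}

/-- `(s, t)`-weak tractability for the absolute error criterion (worst case setting, arbitrary
continuous linear functionals as information). -/
def IsWeaklyTractable (S : ∀ d, F d →L[𝕜] G d) (s t : ℝ) : Prop :=
  Tendsto (fun p : ℝ × ℕ =>
      Real.log (absComplexity p.1 (S p.2)) / (p.1 ^ (-s) + (p.2 : ℝ) ^ t))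
    (absLimit S) (𝓝 0)

end Tractability

/-! ### Hilbert space tensor powers of a space and of an operator -/

/-- A bundled Hilbert space over `𝕜`. -/
structure HilbertSp (𝕜 : Type u) [RCLike 𝕜] where
  /-- the underlying type -/
  carrier : Type v
  [instNorm : NormedAddCommGroup carrier]
  [instInner : InnerProductSpace 𝕜 carrier]
  [instComplete : CompleteSpace carrier]

attribute [instance] HilbertSp.instNorm HilbertSp.instInner HilbertSp.instComplete

section TensorPower

variable (𝕜 : Type u) [RCLike 𝕜]
  (H : Type v) [NormedAddCommGroup H] [InnerProductSpace 𝕜 H] [CompleteSpace H]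

/-- The `(k + 1)`-fold Hilbert space tensor power of `H`: in each step, the completion of the
algebraic tensor product with its canonical inner product
`⟪x ⊗ y, x' ⊗ y'⟫ = ⟪x, x'⟫ * ⟪y, y'⟫`. -/
def hilbertPowSucc : ℕ → HilbertSp.{u, v} 𝕜
  | 0 => ⟨H⟩
  | k + 1 => ⟨UniformSpace.Completion ((hilbertPowSucc k).carrier ⊗[𝕜] H)⟩

/-- The `d`-fold Hilbert space tensor power of `H`, for `1 ≤ d`. -/
abbrev HilbertPow (d : ℕ) : Type v := (hilbertPowSucc 𝕜 H (d - 1)).carrier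

variable {𝕜 H}
  {G : Type w} [NormedAddCommGroup G] [InnerProductSpace 𝕜 G] [CompleteSpace G]

/-- The `(k + 1)`-fold tensor power of an operator: in each step, the continuous extension of
`x ⊗ y ↦ S_k x ⊗ S y` to the completed tensor products. -/
def tensorPowSucc (S : H →L[𝕜] G) :
    (k : ℕ) → (hilbertPowSucc 𝕜 H k).carrier →L[𝕜] (hilbertPowSucc 𝕜 G k).carrier
  | 0 => S
  | k + 1 => (TensorProduct.mapL (tensorPowSucc S k) S).completion

/-- The linear tensor product problem generated by `S`: the operator in dimension `d`, `1 ≤ d`, is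
the `d`-fold tensor power of `S`. -/
def tensorProblem (S : H →L[𝕜] G) (d : ℕ) : HilbertPow 𝕜 H d →L[𝕜] HilbertPow 𝕜 G d :=
  tensorPowSucc S (d - 1)

/-! ### Eigenvalues of `S* S` -/

/-- The operator `W = S* S` as an endomorphism of `H`. -/
def gramOp (S : H →L[𝕜] G) : Module.End 𝕜 H :=
  ((ContinuousLinearMap.adjoint S ∘L S : H →L[𝕜] H) : H →ₗ[𝕜] H)

/-- The number, with multiplicities, of the eigenvalues of `S* S` which are at least `x` (for
compact `S` and `0 < x` this number is finite). -/
def eigenvalueCount (S : H →L[𝕜] G) (x : ℝ) : ℕ :=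
  Module.finrank 𝕜
    (⨆ (μ : ℝ) (_ : x ≤ μ), (gramOp S).eigenspace ((μ : ℝ) : 𝕜) : Submodule 𝕜 H)

/-- The `n`-th largest eigenvalue `λ_n` of `S* S`, counted with multiplicities, for `n = 1, 2, …`:
the largest `x > 0` such that at least `n` eigenvalues are at least `x`, and `0` if there are fewer
than `n` positive eigenvalues. (Only `1 ≤ n` is meaningful.) -/
def eigenvalueSeq (S : H →L[𝕜] G) (n : ℕ) : ℝ :=
  sSup {x : ℝ | 0 < x ∧ n ≤ eigenvalueCount S x}

/-- The multiplicity of the largest eigenvalue `λ_1` of `S* S`. -/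
def topMultiplicity (S : H →L[𝕜] G) : ℕ :=
  Module.finrank 𝕜 ((gramOp S).eigenspace ((eigenvalueSeq S 1 : ℝ) : 𝕜))

/-- The rescaled operator `S' = λ_1 ^ (-1/2) • S`. -/
def rescaledOp (S : H →L[𝕜] G) : H →L[𝕜] G :=
  (((√(eigenvalueSeq S 1))⁻¹ : ℝ) : 𝕜) • S

/-- The decay condition `λ_n = o((ln n) ^ (-2/s))`. -/
def LogDecay (S : H →L[𝕜] G) (s : ℝ) : Prop :=
  Tendsto (fun n : ℕ => eigenvalueSeq S n / Real.log n ^ (-(2 / s))) atTop (𝓝 0)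

/-- The quantity `max_{ℓ = 1, …, d} ℓ * ln n^abs((ε / λ_1 ^ (d/2)) ^ (1/ℓ), S')`, for `1 ≤ d`. -/
def maxLogComplexity (S : H →L[𝕜] G) (ε : ℝ) (d : ℕ) : ℝ :=
  ⨆ l : Finset.Icc 1 d, ((l : ℕ) : ℝ) * Real.log
    (absComplexity ((ε / eigenvalueSeq S 1 ^ ((d : ℝ) / 2)) ^ (1 / ((l : ℕ) : ℝ))) (rescaledOp S))

end TensorPower

end

/-!
The operator `S* S` is compact and self-adjoint, so the source space has an orthonormal basis
`b i` of eigenvectors with eigenvalues `μ i ≥ 0` (`exists_diagonalizedBy`). Equivalently, the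
images `S (b i)` are pairwise orthogonal with `‖S (b i)‖ ^ 2 = μ i`. This property passes to
completed tensor products (`DiagonalizedBy.tensor_completion`), hence the `d`-fold tensor power is
diagonalized with the eigenvalues `∏ j, μ (f j)`, `f : Fin d → ι`. For a diagonalized operator the
information complexity at `ε` is the number of eigenvalues above `ε ^ 2`
(`DiagonalizedBy.absComplexity_eq`): projecting onto these eigenvectors is good enough, and fewer
functionals have a common zero in their span. So the theorem is about counting the tuples `f` with
`∏ j, a (f j) > y`, where `0 ≤ a ≤ 1`; here `a = μ` and `y = ε ^ 2` if `λ_1 ≤ 1`, and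
`a = μ / λ_1`, `y = ε ^ 2 / λ_1 ^ d` in general.

The upper bound rests on order statistics. The product of the `l` smallest entries of such a tuple
exceeds `y`, so the `l`-th smallest entry exceeds `y ^ (1 / l)`. A tuple with at most `K` nontrivial
entries is determined by their positions and values, which gives (`log_ncard_lt_prod_le`)
`ln n ≤ K ln d + ∑_{l ≤ K} ln #{i | a i > y ^ (1 / l)}`.
Conversely, `l` free entries above `y ^ (1 / l)` show `l ln #{i | a i > y ^ (1 / l)} ≤ ln n`
(`mul_log_ncard_le`).

Under the decay condition, `ln #{i | μ i > x ^ 2} ≤ η x ^ (-s) + C_η`. The sum over `l` is then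
`η ε ^ (-s)` up to terms of the order of `K` and `(1 + ln d) ε ^ (-s / 2)`, since only the first
root `(ε ^ (-s)) ^ (1 / l)` is large (`sum_rpow_inv_le`). What remains is `K (1 + ln d)`. It is
negligible if `K = O(ln ε⁻¹)`, which holds for `λ_1 < 1`, where `ε < λ_1 ^ (d / 2)` bounds `d`, and
for `λ_1 = 1` simple, where each nontrivial entry costs a fixed factor; for `K = d` it is negligible
if `t > 1`. For `λ_1 > 1` the same bounds compare `ln n` with the maximum over `l`, up to the
harmonic sum `∑ 1 / l ≤ 1 + ln d`.

The necessity of the decay condition is seen at `d = 1`. If `λ_1 > 1`, or if `λ_1 = 1` is a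
multiple eigenvalue, then at a fixed `ε` a positive fraction of the coordinates can be chosen
between two indices, so `n` grows exponentially in `d`, which forces `t > 1`.
-/

/-! ### Operators diagonalized by an orthonormal basis -/

section Diagonal

variable {𝕜 : Type*} [RCLike 𝕜]
  {F : Type*} [NormedAddCommGroup F] [InnerProductSpace 𝕜 F]
  {K : Type*} [NormedAddCommGroup K] [InnerProductSpace 𝕜 K]
  {ι : Type*}

/-- `T` is diagonalized by the orthonormal basis `b` with eigenvalues `μ`: the family `b` is
orthonormal and total, and its images under `T` are pairwise orthogonal with `‖T (b i)‖ ^ 2 = μ i`.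
For complete spaces this says that `b` is a Hilbert basis of eigenvectors of `T* T`; in this form
it needs neither completeness nor an adjoint, and it is visibly stable under tensor products. -/
structure DiagonalizedBy (T : F →L[𝕜] K) (b : ι → F) (μ : ι → ℝ) : Prop where
  orthonormal : Orthonormal 𝕜 b
  dense : (Submodule.span 𝕜 (Set.range b)).topologicalClosure = ⊤
  ortho_map : Pairwise fun i j => inner 𝕜 (T (b i)) (T (b j)) = 0
  norm_map : ∀ i, ‖T (b i)‖ ^ 2 = μ i

theorem norm_sum_smul_sq_of_pairwise_orthogonal {v : ι → K}
    (hv : Pairwise fun i j => inner 𝕜 (v i) (v j) = 0) (s : Finset ι) (c : ι → 𝕜) :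
    ‖∑ i ∈ s, c i • v i‖ ^ 2 = ∑ i ∈ s, ‖c i‖ ^ 2 * ‖v i‖ ^ 2 := by
  classical
  have key : inner 𝕜 (∑ i ∈ s, c i • v i) (∑ i ∈ s, c i • v i)
      = ((∑ i ∈ s, ‖c i‖ ^ 2 * ‖v i‖ ^ 2 : ℝ) : 𝕜) := by
    rw [sum_inner]
    push_cast
    refine Finset.sum_congr rfl fun i hi => ?_
    rw [inner_sum, Finset.sum_eq_single i]
    · rw [inner_smul_left, inner_smul_right, inner_self_eq_norm_sq_to_K, ← mul_assoc,
        RCLike.conj_mul]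
    · intro j _ hj
      rw [inner_smul_left, inner_smul_right, hv hj.symm, mul_zero, mul_zero]
    · exact fun h => absurd hi h
  rw [inner_self_eq_norm_sq_to_K] at key
  exact_mod_cast key

/-- An operator which maps an orthonormal basis to pairwise orthogonal vectors of norm at most
`r` has norm at most `r`. -/
theorem norm_apply_le_of_pairwise_orthogonal {b : ι → F} (hb : Orthonormal 𝕜 b)
    (hd : (Submodule.span 𝕜 (Set.range b)).topologicalClosure = ⊤) {D : F →L[𝕜] K}
    (ho : Pairwise fun i j => inner 𝕜 (D (b i)) (D (b j)) = 0) {r : ℝ} (hr : 0 ≤ r)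
    (hD : ∀ i, ‖D (b i)‖ ^ 2 ≤ r ^ 2) (f : F) : ‖D f‖ ≤ r * ‖f‖ := by
  have hf : f ∈ closure (Submodule.span 𝕜 (Set.range b) : Set F) := by
    rw [← Submodule.topologicalClosure_coe, hd]; trivial
  refine closure_minimal (s := (Submodule.span 𝕜 (Set.range b) : Set F))
    (t := {f | ‖D f‖ ≤ r * ‖f‖}) ?_ (isClosed_le (by fun_prop) (by fun_prop)) hf
  intro g hg
  obtain ⟨c, rfl⟩ := (Finsupp.mem_span_range_iff_exists_finsupp).1 hg
  simp only [Finsupp.sum, Set.mem_ofPred_eq, map_sum, map_smul]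
  refine le_of_sq_le_sq ?_ (by positivity)
  rw [mul_pow, norm_sum_smul_sq_of_pairwise_orthogonal ho,
    norm_sum_smul_sq_of_pairwise_orthogonal (𝕜 := 𝕜) (fun i j h => hb.2 h), Finset.mul_sum]
  refine Finset.sum_le_sum fun i _ => ?_
  rw [hb.1 i, one_pow, mul_one, mul_comm]
  exact mul_le_mul_of_nonneg_right (hD i) (by positivity)

theorem worstCaseError_nonneg (T : F →L[𝕜] K) (A : F → K) : 0 ≤ worstCaseError T A := by
  refine Real.sSup_nonneg ?_
  rintro _ ⟨f, _, rfl⟩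
  exact norm_nonneg _

theorem bddAbove_error (T : F →L[𝕜] K) {n : ℕ} (L : Fin n → (F →L[𝕜] 𝕜)) (g : Fin n → K) :
    BddAbove ((fun f => ‖T f - linearAlgorithm L g f‖) '' Metric.closedBall (0 : F) 1) := by
  refine ⟨‖T - ∑ i, (L i).smulRight (g i)‖, ?_⟩
  rintro _ ⟨f, hf, rfl⟩
  have h := (T - ∑ i, (L i).smulRight (g i)).le_opNorm f
  simp only [sub_apply, sum_apply,
    ContinuousLinearMap.smulRight_apply] at h
  refine h.trans (mul_le_of_le_one_right (norm_nonneg _) ?_)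
  simpa using hf

theorem minimalError_le (T : F →L[𝕜] K) {n : ℕ} (L : Fin n → (F →L[𝕜] 𝕜)) (g : Fin n → K) :
    minimalError T n ≤ worstCaseError T (linearAlgorithm L g) :=
  ciInf_le (f := fun A : (Fin n → (F →L[𝕜] 𝕜)) × (Fin n → K) =>
    worstCaseError T (linearAlgorithm A.1 A.2))
    ⟨0, by rintro _ ⟨A, rfl⟩; exact worstCaseError_nonneg _ _⟩ (L, g)

namespace DiagonalizedBy

variable {T : F →L[𝕜] K} {b : ι → F} {μ : ι → ℝ}

theorem nonneg (h : DiagonalizedBy T b μ) (i : ι) : 0 ≤ μ i := by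
  rw [← h.norm_map]; positivity

theorem smul (h : DiagonalizedBy T b μ) (c : ℝ) :
    DiagonalizedBy ((c : 𝕜) • T) b (fun i => c ^ 2 * μ i) where
  orthonormal := h.orthonormal
  dense := h.dense
  ortho_map i j hij := by simp [inner_smul_left, inner_smul_right, h.ortho_map hij]
  norm_map i := by simp [norm_smul, mul_pow, h.norm_map]

/-- Projecting onto the basis vectors with `ε ^ 2 < μ i` leaves an error of at most `ε`. -/
theorem minimalError_ncard_le (h : DiagonalizedBy T b μ) {ε : ℝ} (hε : 0 ≤ ε)
    (hfin : {i | ε ^ 2 < μ i}.Finite) : minimalError T {i | ε ^ 2 < μ i}.ncard ≤ ε := by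
  classical
  have : Fintype {i | ε ^ 2 < μ i} := hfin.fintype
  set J := {i | ε ^ 2 < μ i} with hJ
  have e : Fin J.ncard ≃ J := (Fintype.equivFinOfCardEq
    (by rw [Set.ncard_eq_toFinset_card', Set.toFinset_card])).symm
  let L : Fin J.ncard → (F →L[𝕜] 𝕜) := fun k => innerSL 𝕜 (b (e k))
  let g : Fin J.ncard → K := fun k => T (b (e k))
  refine (minimalError_le T L g).trans ?_
  let D : F →L[𝕜] K := T - ∑ k, (L k).smulRight (g k)
  have hDf : ∀ f, T f - linearAlgorithm L g f = D f := fun f => by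
    simp [D, linearAlgorithm]
  have hD : ∀ i, D (b i) = if i ∈ J then 0 else T (b i) := by
    intro i
    rw [← hDf]
    simp only [linearAlgorithm, L, g, innerSL_apply_apply]
    rw [e.sum_comp (fun j : J => inner 𝕜 (b j) (b i) • T (b j))]
    split_ifs with hi
    · rw [Finset.sum_eq_single ⟨i, hi⟩]
      · simp [inner_self_eq_norm_sq_to_K, h.orthonormal.1 i]
      · intro j _ hj
        rw [h.orthonormal.2 (fun hh => hj (Subtype.ext hh)), zero_smul]
      · simp
    · rw [Finset.sum_eq_zero, sub_zero]
      rintro ⟨j, hj⟩ _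
      rw [h.orthonormal.2 (fun hh : j = i => hi (hh ▸ hj)), zero_smul]
  have hle : ∀ f, ‖D f‖ ≤ ε * ‖f‖ := by
    refine norm_apply_le_of_pairwise_orthogonal h.orthonormal h.dense ?_ hε ?_
    · intro i j hij
      rw [hD, hD]
      split_ifs <;> simp [h.ortho_map hij]
    · intro i
      rw [hD]
      split_ifs with hi
      · simp [sq_nonneg]
      · rw [h.norm_map]; exact not_lt.1 hi
  refine Real.sSup_le ?_ hε
  rintro _ ⟨f, hf, rfl⟩
  simp only [hDf]
  refine (hle f).trans (mul_le_of_le_one_right hε ?_)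
  simpa using hf

/-- Fewer than `#{i | ε ^ 2 < μ i}` functionals have a common zero in the span of these basis
vectors; there the algorithm vanishes while `T` is larger than `ε`. -/
theorem lt_minimalError (h : DiagonalizedBy T b μ) {ε : ℝ}
    (hfin : {i | ε ^ 2 < μ i}.Finite) {n : ℕ} (hn : n < {i | ε ^ 2 < μ i}.ncard) :
    ε < minimalError T n := by
  classical
  obtain ⟨J, hJ⟩ := hfin.exists_finset_coe
  rw [← hJ, Set.ncard_coe_finset] at hn
  have hJ' : ∀ i ∈ J, ε ^ 2 < μ i := fun i hi => by
    have : i ∈ (J : Set ι) := hi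
    rwa [hJ] at this
  obtain ⟨i₀, hi₀, hmin⟩ := J.exists_min_image μ (Finset.card_pos.1 (by omega))
  have hr : ε < √(μ i₀) := Real.lt_sqrt_of_sq_lt (hJ' i₀ hi₀)
  refine hr.trans_le (le_ciInf fun A => ?_)
  obtain ⟨L, g⟩ := A
  let Φ : (J → 𝕜) →ₗ[𝕜] (Fin n → 𝕜) :=
    { toFun := fun c k => L k (∑ i, c i • b i)
      map_add' := fun c d => by ext k; simp [add_smul, Finset.sum_add_distrib]
      map_smul' := fun a c => by ext k; simp [mul_assoc, Finset.mul_sum] }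
  have hker : LinearMap.ker Φ ≠ ⊥ := Φ.ker_ne_bot_of_finrank_lt (by simpa using hn)
  obtain ⟨c, hc, hc0⟩ := (Submodule.ne_bot_iff _).1 hker
  set f : F := ∑ i, c i • b i with hf
  have hLf : ∀ k, L k f = 0 := fun k => congrFun (LinearMap.mem_ker.1 hc) k
  have hnf : ‖f‖ ^ 2 = ∑ i, ‖c i‖ ^ 2 := by
    rw [hf, norm_sum_smul_sq_of_pairwise_orthogonal (𝕜 := 𝕜) (v := fun i : J => b i)
      (fun i j hij => h.orthonormal.2 (fun hh => hij (Subtype.ext hh)))]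
    simp [h.orthonormal.1]
  have hTf : ‖T f‖ ^ 2 = ∑ i, ‖c i‖ ^ 2 * μ i := by
    simp only [hf, map_sum, map_smul]
    rw [norm_sum_smul_sq_of_pairwise_orthogonal (𝕜 := 𝕜) (v := fun i : J => T (b i))
      (fun i j hij => h.ortho_map (fun hh => hij (Subtype.ext hh)))]
    simp [h.norm_map]
  have hlow : √(μ i₀) * ‖f‖ ≤ ‖T f‖ := by
    refine le_of_sq_le_sq ?_ (norm_nonneg _)
    rw [mul_pow, Real.sq_sqrt (h.nonneg _), hnf, hTf, Finset.mul_sum]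
    refine Finset.sum_le_sum fun i _ => ?_
    rw [mul_comm]
    exact mul_le_mul_of_nonneg_left (hmin _ i.2) (by positivity)
  have hf0 : 0 < ‖f‖ := by
    obtain ⟨i, hi⟩ := Function.ne_iff.1 hc0
    have h1 : 0 < ‖c i‖ ^ 2 := by have := norm_pos_iff.2 hi; positivity
    have h2 : ‖c i‖ ^ 2 ≤ ‖f‖ ^ 2 := by
      rw [hnf]
      exact Finset.single_le_sum (f := fun i => ‖c i‖ ^ 2) (fun _ _ => by positivity)
        (Finset.mem_univ i)
    exact lt_of_le_of_ne (norm_nonneg _) fun h0 => by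
      rw [← h0] at h2; exact absurd (h1.trans_le h2) (by norm_num)
  -- test the algorithm at the normalized vector
  have hmem : ((‖f‖⁻¹ : ℝ) : 𝕜) • f ∈ Metric.closedBall (0 : F) 1 := by
    simp [norm_smul, hf0.ne']
  refine le_trans ?_ (le_csSup (bddAbove_error T L g) ⟨_, hmem, rfl⟩)
  have hA : linearAlgorithm L g (((‖f‖⁻¹ : ℝ) : 𝕜) • f) = 0 := by
    simp [linearAlgorithm, hLf]
  simp only [hA, sub_zero, map_smul, norm_smul]
  rw [RCLike.norm_ofReal, abs_of_pos (inv_pos.2 hf0), le_inv_mul_iff₀ hf0, mul_comm]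
  exact hlow

theorem absComplexity_eq (h : DiagonalizedBy T b μ) {ε : ℝ} (hε : 0 ≤ ε)
    (hfin : {i | ε ^ 2 < μ i}.Finite) : absComplexity ε T = {i | ε ^ 2 < μ i}.ncard := by
  refine le_antisymm (Nat.sInf_le (h.minimalError_ncard_le hε hfin)) ?_
  refine le_csInf ⟨_, h.minimalError_ncard_le hε hfin⟩ fun n hn => ?_
  by_contra! hlt
  exact absurd hn (not_le.2 (h.lt_minimalError hfin hlt))

theorem lt_minimalError_zero_iff (h : DiagonalizedBy T b μ) {ε : ℝ} (hε : 0 ≤ ε)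
    (hfin : {i | ε ^ 2 < μ i}.Finite) : ε < minimalError T 0 ↔ ∃ i, ε ^ 2 < μ i := by
  constructor
  · intro hlt
    by_contra! hno
    have h0 : {i | ε ^ 2 < μ i} = ∅ := Set.eq_empty_of_forall_notMem fun i hi => (hno i).not_gt hi
    have := h.minimalError_ncard_le hε hfin
    rw [h0, Set.ncard_empty] at this
    exact absurd hlt this.not_gt
  · rintro ⟨i, hi⟩
    exact h.lt_minimalError hfin ((Set.ncard_pos hfin).2 ⟨i, hi⟩)

end DiagonalizedBy

end Diagonal

/-! ### The spectral theorem for `S* S` -/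

section Spectral

variable {𝕜 : Type u} [RCLike 𝕜]
  {H : Type v} [NormedAddCommGroup H] [InnerProductSpace 𝕜 H]
  {G : Type w} [NormedAddCommGroup G] [InnerProductSpace 𝕜 G]

/-- Orthogonal vectors `S (b i)` of norm bounded below have no convergent subsequence. -/
theorem DiagonalizedBy.finite_lt_of_isCompactOperator {ι : Type*} {S : H →L[𝕜] G} {b : ι → H}
    {μ : ι → ℝ} (h : DiagonalizedBy S b μ) (hS : IsCompactOperator S) {x : ℝ} (hx : 0 < x) :
    {i | x < μ i}.Finite := by
  by_contra hinf
  let e : ℕ ↪ {i | x < μ i} := Set.Infinite.natEmbedding _ hinf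
  obtain ⟨C, hC, hSC⟩ := hS.image_closedBall_subset_compact (𝕜₁ := 𝕜)
    (f := (S : H →ₗ[𝕜] G)) 1
  have hmem : ∀ n, S (b (e n)) ∈ C := fun n => hSC ⟨b (e n), by simp [h.orthonormal.1], rfl⟩
  obtain ⟨a, -, φ, hφ, hlim⟩ := hC.tendsto_subseq hmem
  have hcau := hlim.cauchySeq
  rw [Metric.cauchySeq_iff] at hcau
  obtain ⟨N, hN⟩ := hcau (√x) (Real.sqrt_pos.2 hx)
  have h1 := hN N le_rfl (N + 1) (Nat.le_succ N)
  have hne : (e (φ N) : ι) ≠ e (φ (N + 1)) := fun hh =>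
    (hφ (Nat.lt_succ_self N)).ne (e.injective (Subtype.ext hh))
  rw [dist_eq_norm, Real.lt_sqrt (norm_nonneg _)] at h1
  simp only [Function.comp_apply] at h1
  rw [@norm_sub_sq 𝕜, h.ortho_map hne, h.norm_map, h.norm_map] at h1
  have h2 : x < μ (e (φ N)) := (e (φ N)).2
  have h3 := h.nonneg (e (φ (N + 1)))
  simp at h1
  linarith

theorem DiagonalizedBy.finrank_span_image {ι : Type*} {S : H →L[𝕜] G} {b : ι → H}
    {μ : ι → ℝ} (h : DiagonalizedBy S b μ) {J : Set ι} (hJ : J.Finite) :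
    Module.finrank 𝕜 (Submodule.span 𝕜 (b '' J)) = J.ncard := by
  have : Fintype J := hJ.fintype
  have := finrank_span_eq_card
    (h.orthonormal.linearIndependent.comp ((↑) : J → ι) Subtype.val_injective)
  rw [Set.image_eq_range, Set.ncard_eq_toFinset_card', Set.toFinset_card]
  exact this

variable [CompleteSpace H]

theorem DiagonalizedBy.eq_zero_of_inner_eq_zero {ι : Type*} {S : H →L[𝕜] G} {b : ι → H} {μ : ι → ℝ}
    (h : DiagonalizedBy S b μ) {x : H} (hx : ∀ i, inner 𝕜 (b i) x = 0) : x = 0 := by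
  have h1 := Submodule.topologicalClosure_eq_top_iff.1 h.dense
  rw [← Submodule.mem_bot 𝕜, ← h1, Submodule.mem_orthogonal]
  intro u hu
  induction hu using Submodule.span_induction with
  | mem _ hy => obtain ⟨i, rfl⟩ := hy; exact hx i
  | zero => simp
  | add _ _ _ _ h1 h2 => rw [inner_add_left, h1, h2, add_zero]
  | smul c _ _ h1 => rw [inner_smul_left, h1, mul_zero]

variable [CompleteSpace G]

theorem gramOp_apply (S : H →L[𝕜] G) (x : H) :
    gramOp S x = ContinuousLinearMap.adjoint S (S x) := rfl

theorem inner_gramOp (S : H →L[𝕜] G) (x y : H) :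
    inner 𝕜 x (gramOp S y) = inner 𝕜 (S x) (S y) := by
  rw [gramOp_apply, ContinuousLinearMap.adjoint_inner_right]

/-- The spectral theorem: eigenvectors of the compact operator `S* S` diagonalize `S`. -/
theorem exists_diagonalizedBy (S : H →L[𝕜] G) (hS : IsCompactOperator S) :
    ∃ (ι : Type (max u v)) (b : ι → H) (μ : ι → ℝ), DiagonalizedBy S b μ := by
  let W : H →L[𝕜] H := ContinuousLinearMap.adjoint S ∘L S
  have hW : IsCompactOperator W := hS.clm_comp (ContinuousLinearMap.adjoint S)
  have hsym : (W : H →ₗ[𝕜] H).IsSymmetric := fun x y => by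
    simp [W, ContinuousLinearMap.adjoint_inner_left, ContinuousLinearMap.adjoint_inner_right]
  have hbot := ContinuousLinearMap.orthogonalComplement_iSup_eigenspaces_eq_bot hW hsym
  let V : 𝕜 → Submodule 𝕜 H := fun z => Module.End.eigenspace (W : Module.End 𝕜 H) z
  have hcl : ∀ z, IsClosed (V z : Set H) := fun z => by
    have : (V z : Set H) = {x | W x = z • x} := by
      ext x; simp [V]
    rw [this]
    exact isClosed_eq (by fun_prop) (by fun_prop)
  have : ∀ z, CompleteSpace (V z) := fun z => (hcl z).completeSpace_coe
  choose w B hB using fun z => exists_hilbertBasis 𝕜 (V z)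
  let b : (Σ z, w z) → H := fun a => (B a.1 a.2 : V a.1)
  have hb : Orthonormal 𝕜 b :=
    (hsym.orthogonalFamily_eigenspaces).orthonormal_sigma_orthonormal
      (v_family := fun z => B z) (fun z => (B z).orthonormal)
  have hWb : ∀ a, W (b a) = a.1 • b a := fun a =>
    Module.End.mem_eigenspace_iff.1 (B a.1 a.2).2
  have hin : ∀ a a', inner 𝕜 (S (b a)) (S (b a')) = a'.1 * inner 𝕜 (b a) (b a') := fun a a' => by
    rw [← inner_gramOp]
    exact (congrArg _ (hWb a')).trans (inner_smul_right _ _ _)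
  refine ⟨Σ z, w z, b, fun a => ‖S (b a)‖ ^ 2, hb, ?_, ?_, fun _ => rfl⟩
  · rw [eq_top_iff, ← (Submodule.topologicalClosure_eq_top_iff).2 hbot]
    refine Submodule.topologicalClosure_minimal _ (iSup_le fun z => ?_)
      (Submodule.isClosed_topologicalClosure _)
    intro x hx
    have hx' : (⟨x, hx⟩ : V z) ∈ (Submodule.span 𝕜 (Set.range (B z))).topologicalClosure := by
      rw [(B z).dense_span]; trivial
    rw [← SetLike.mem_coe, Submodule.topologicalClosure_coe] at hx' ⊢
    refine map_mem_closure (f := ((↑) : V z → H)) continuous_subtype_val hx' ?_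
    intro y hy
    have : (V z).subtype y ∈ (Submodule.span 𝕜 (Set.range (B z))).map (V z).subtype :=
      Submodule.mem_map_of_mem hy
    rw [Submodule.map_span] at this
    refine Submodule.span_mono ?_ this
    rintro _ ⟨_, ⟨i, rfl⟩, rfl⟩
    exact ⟨⟨z, i⟩, rfl⟩
  · intro a a' haa'
    rw [hin, hb.2 haa', mul_zero]

namespace DiagonalizedBy

variable {ι : Type*} {S : H →L[𝕜] G} {b : ι → H} {μ : ι → ℝ}

theorem gramOp_basis (h : DiagonalizedBy S b μ) (i : ι) :
    gramOp S (b i) = (μ i : 𝕜) • b i := by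
  refine sub_eq_zero.1 (h.eq_zero_of_inner_eq_zero fun j => ?_)
  rw [inner_sub_right, inner_gramOp, inner_smul_right]
  by_cases hij : j = i
  · subst hij
    rw [inner_self_eq_norm_sq_to_K, inner_self_eq_norm_sq_to_K, h.orthonormal.1, ← h.norm_map]
    simp
  · rw [h.ortho_map hij, h.orthonormal.2 hij]; simp

theorem eigenspace_gramOp (h : DiagonalizedBy S b μ) {x : ℝ} (hfin : {i | μ i = x}.Finite) :
    (gramOp S).eigenspace (x : 𝕜) = Submodule.span 𝕜 (b '' {i | μ i = x}) := by
  classical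
  refine le_antisymm ?_ (Submodule.span_le.2 ?_)
  · intro v hv
    rw [Module.End.mem_eigenspace_iff] at hv
    obtain ⟨J, hJ⟩ := hfin.exists_finset_coe
    have hcoef : ∀ i, i ∉ J → inner 𝕜 (b i) v = 0 := by
      intro i hi
      have h1 : inner 𝕜 (gramOp S (b i)) v = inner 𝕜 (b i) (gramOp S v) := by
        rw [inner_gramOp, ← inner_conj_symm, inner_gramOp, inner_conj_symm]
      rw [hv, h.gramOp_basis, inner_smul_left, inner_smul_right, RCLike.conj_ofReal,
        ← sub_eq_zero, ← sub_mul, mul_eq_zero, sub_eq_zero] at h1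
      refine h1.resolve_left fun hh => hi ?_
      have : i ∈ {i | μ i = x} := by exact_mod_cast hh
      rw [← hJ] at this
      exact_mod_cast this
    have hv' : v = ∑ i ∈ J, inner 𝕜 (b i) v • b i := by
      refine sub_eq_zero.1 (h.eq_zero_of_inner_eq_zero fun j => ?_)
      rw [inner_sub_right, inner_sum]
      simp only [inner_smul_right, orthonormal_iff_ite.1 h.orthonormal, mul_ite, mul_one, mul_zero,
        Finset.sum_ite_eq]
      split_ifs with hj
      · exact sub_self _
      · rw [hcoef j hj, sub_zero]
    rw [hv']
    refine Submodule.sum_mem _ fun i hi =>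
      Submodule.smul_mem _ _ (Submodule.subset_span ⟨i, ?_, rfl⟩)
    rw [← hJ]; exact hi
  · rintro _ ⟨i, hi, rfl⟩
    have hi' : μ i = x := hi
    rw [SetLike.mem_coe, Module.End.mem_eigenspace_iff, h.gramOp_basis, hi']

theorem finite_le (hc : ∀ x, 0 < x → {i | x < μ i}.Finite) {x : ℝ} (hx : 0 < x) :
    {i | x ≤ μ i}.Finite :=
  (hc (x / 2) (by positivity)).subset fun i (hi : x ≤ μ i) => show x / 2 < μ i by linarith

theorem eigenvalueCount_eq (h : DiagonalizedBy S b μ) (hc : ∀ x, 0 < x → {i | x < μ i}.Finite)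
    {x : ℝ} (hx : 0 < x) : eigenvalueCount S x = {i | x ≤ μ i}.ncard := by
  have hsup : (⨆ (ν : ℝ) (_ : x ≤ ν), (gramOp S).eigenspace ((ν : ℝ) : 𝕜))
      = Submodule.span 𝕜 (b '' {i | x ≤ μ i}) := by
    have h1 : ∀ ν : ℝ, x ≤ ν → (gramOp S).eigenspace ((ν : ℝ) : 𝕜)
        = Submodule.span 𝕜 (b '' {i | μ i = ν}) := fun ν hν =>
      h.eigenspace_gramOp ((finite_le hc hx).subset fun i (hi : μ i = ν) => hν.trans_eq hi.symm)
    refine le_antisymm (iSup₂_le fun ν hν => ?_) (Submodule.span_le.2 ?_)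
    · rw [h1 ν hν]
      exact Submodule.span_mono (Set.image_mono fun i (hi : μ i = ν) => hν.trans_eq hi.symm)
    · rintro _ ⟨i, hi, rfl⟩
      refine Submodule.mem_iSup_of_mem (μ i) (Submodule.mem_iSup_of_mem hi ?_)
      rw [h1 _ hi]
      exact Submodule.subset_span ⟨i, rfl, rfl⟩
  rw [eigenvalueCount, hsup, h.finrank_span_image (finite_le hc hx)]

/-- The defining property of the ordered eigenvalues, in terms of the counting function. -/
theorem lt_eigenvalueSeq_iff (h : DiagonalizedBy S b μ) (hc : ∀ x, 0 < x → {i | x < μ i}.Finite)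
    {x : ℝ} (hx : 0 < x) {n : ℕ} (hn : 1 ≤ n) :
    x < eigenvalueSeq S n ↔ n ≤ {i | x < μ i}.ncard := by
  have hbdd : BddAbove {y : ℝ | 0 < y ∧ n ≤ eigenvalueCount S y} := by
    refine ⟨‖S‖ ^ 2, ?_⟩
    rintro y ⟨hy, hny⟩
    rw [h.eigenvalueCount_eq hc hy] at hny
    obtain ⟨i, hi⟩ := (Set.ncard_pos (finite_le hc hy)).1 (hn.trans hny)
    refine (show y ≤ μ i from hi).trans ?_
    rw [← h.norm_map]
    have := S.le_opNorm (b i)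
    rw [h.orthonormal.1, mul_one] at this
    gcongr
  constructor
  · intro hlt
    have hne : {y : ℝ | 0 < y ∧ n ≤ eigenvalueCount S y}.Nonempty := by
      by_contra hne
      rw [Set.not_nonempty_iff_eq_empty] at hne
      rw [eigenvalueSeq, hne, Real.sSup_empty] at hlt
      exact hlt.not_gt hx
    obtain ⟨y, ⟨hy, hny⟩, hxy⟩ := exists_lt_of_lt_csSup hne hlt
    rw [h.eigenvalueCount_eq hc hy] at hny
    exact hny.trans (Set.ncard_le_ncard (fun i (hi : y ≤ μ i) => hxy.trans_le hi) (hc x hx))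
  · intro hle
    obtain ⟨i₀, hi₀, hmin⟩ := (hc x hx).exists_minimalFor μ _
      ((Set.ncard_pos (hc x hx)).1 (hn.trans hle))
    have hi₀' : x < μ i₀ := hi₀
    refine hi₀'.trans_le (le_csSup hbdd ⟨hx.trans hi₀', ?_⟩)
    rw [h.eigenvalueCount_eq hc (hx.trans hi₀')]
    refine hle.trans (Set.ncard_le_ncard (fun i hi => ?_) (finite_le hc (hx.trans hi₀')))
    rcases le_total (μ i₀) (μ i) with h1 | h1
    · exact h1
    · exact hmin hi h1

theorem topMultiplicity_eq (h : DiagonalizedBy S b μ) (hc : ∀ x, 0 < x → {i | x < μ i}.Finite)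
    (h1 : 0 < eigenvalueSeq S 1) :
    topMultiplicity S = {i | μ i = eigenvalueSeq S 1}.ncard := by
  have hfin : {i | μ i = eigenvalueSeq S 1}.Finite :=
    (finite_le hc h1).subset fun i (hi : μ i = _) => hi.ge
  rw [topMultiplicity, h.eigenspace_gramOp hfin, h.finrank_span_image hfin]

end DiagonalizedBy

end Spectral

/-! ### Tensor powers -/

section TensorPowers

variable {𝕜 : Type u} [RCLike 𝕜]

open UniformSpace in
/-- The elementary tensors of two diagonalizing bases diagonalize the completed tensor product of
the operators, with the products as eigenvalues. -/
theorem DiagonalizedBy.tensor_completion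
    {F F' K K' : Type*} [NormedAddCommGroup F] [InnerProductSpace 𝕜 F]
    [NormedAddCommGroup F'] [InnerProductSpace 𝕜 F'] [NormedAddCommGroup K]
    [InnerProductSpace 𝕜 K] [NormedAddCommGroup K'] [InnerProductSpace 𝕜 K']
    {ι ι' : Type*} {T : F →L[𝕜] K} {T' : F' →L[𝕜] K'} {b : ι → F} {b' : ι' → F'}
    {μ : ι → ℝ} {μ' : ι' → ℝ} (h : DiagonalizedBy T b μ) (h' : DiagonalizedBy T' b' μ') :
    DiagonalizedBy (TensorProduct.mapL T T').completion
      (fun p : ι × ι' => ((b p.1 ⊗ₜ[𝕜] b' p.2 : F ⊗[𝕜] F') : Completion (F ⊗[𝕜] F')))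
      (fun p => μ p.1 * μ' p.2) where
  orthonormal := by
    refine ⟨fun p => by simp [h.orthonormal.1, h'.orthonormal.1], fun p q hpq => ?_⟩
    simp only [Completion.inner_coe, TensorProduct.inner_tmul]
    by_cases h1 : p.1 = q.1
    · rw [h'.orthonormal.2 fun h2 => hpq (Prod.ext h1 h2), mul_zero]
    · rw [h.orthonormal.2 h1, zero_mul]
  dense := by
    set Z := (Submodule.span 𝕜 (Set.range fun p : ι × ι' =>
      ((b p.1 ⊗ₜ[𝕜] b' p.2 : F ⊗[𝕜] F') : Completion (F ⊗[𝕜] F')))).topologicalClosure with hZ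
    have hZc : IsClosed (Z : Set (Completion (F ⊗[𝕜] F'))) :=
      Submodule.isClosed_topologicalClosure _
    let q : F →L[𝕜] F' →L[𝕜] Completion (F ⊗[𝕜] F') :=
      (ContinuousLinearMap.compL 𝕜 F' (F ⊗[𝕜] F') _ Completion.toComplL) ∘L
        TensorProduct.mkL 𝕜 F F'
    have hq : ∀ x y, q x y = ((x ⊗ₜ[𝕜] y : F ⊗[𝕜] F') : Completion (F ⊗[𝕜] F')) :=
      fun x y => rfl
    have h0 : ∀ i j, q (b i) (b' j) ∈ Z := fun i j =>
      Submodule.le_topologicalClosure _ (Submodule.subset_span ⟨(i, j), rfl⟩)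
    have h1 : ∀ x j, q x (b' j) ∈ Z := by
      intro x j
      have : (⊤ : Submodule 𝕜 F) ≤ Z.comap (q.flip (b' j)).toLinearMap := by
        rw [← h.dense]
        refine Submodule.topologicalClosure_minimal _ (Submodule.span_le.2 ?_)
          (hZc.preimage (q.flip (b' j)).continuous)
        rintro _ ⟨i, rfl⟩
        exact h0 i j
      exact this (Submodule.mem_top (x := x))
    have h2 : ∀ x y, q x y ∈ Z := by
      intro x y
      have : (⊤ : Submodule 𝕜 F') ≤ Z.comap (q x).toLinearMap := by
        rw [← h'.dense]
        refine Submodule.topologicalClosure_minimal _ (Submodule.span_le.2 ?_)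
          (hZc.preimage (q x).continuous)
        rintro _ ⟨j, rfl⟩
        exact h1 x j
      exact this (Submodule.mem_top (x := y))
    rw [eq_top_iff]
    rintro x -
    induction x using Completion.induction_on with
    | hp => exact hZc
    | ih x =>
      induction x using TensorProduct.induction_on with
      | zero => rw [Completion.coe_zero]; exact Z.zero_mem
      | tmul x y => exact h2 x y
      | add x y hx hy => rw [Completion.coe_add]; exact Z.add_mem hx hy
  ortho_map := by
    intro p q hpq
    simp only [ContinuousLinearMap.completion_apply_coe, TensorProduct.mapL_tmul,
      Completion.inner_coe, TensorProduct.inner_tmul]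
    by_cases h1 : p.1 = q.1
    · rw [h'.ortho_map fun h2 => hpq (Prod.ext h1 h2), mul_zero]
    · rw [h.ortho_map h1, zero_mul]
  norm_map p := by
    simp only [ContinuousLinearMap.completion_apply_coe, TensorProduct.mapL_tmul,
      Completion.norm_coe, TensorProduct.norm_tmul, mul_pow, h.norm_map, h'.norm_map]

theorem DiagonalizedBy.reindex {F K : Type*} [NormedAddCommGroup F] [InnerProductSpace 𝕜 F]
    [NormedAddCommGroup K] [InnerProductSpace 𝕜 K] {ι κ : Type*} {T : F →L[𝕜] K} {b : ι → F}
    {μ : ι → ℝ} (h : DiagonalizedBy T b μ) (e : κ ≃ ι) : DiagonalizedBy T (b ∘ e) (μ ∘ e) where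
  orthonormal := h.orthonormal.comp e e.injective
  dense := by rw [e.surjective.range_comp]; exact h.dense
  ortho_map i j hij := h.ortho_map (e.injective.ne hij)
  norm_map i := h.norm_map (e i)

variable {H : Type v} [NormedAddCommGroup H] [InnerProductSpace 𝕜 H] [CompleteSpace H]
  {G : Type w} [NormedAddCommGroup G] [InnerProductSpace 𝕜 G] [CompleteSpace G]

theorem DiagonalizedBy.tensorPowSucc {ι : Type*} {S : H →L[𝕜] G} {b : ι → H} {μ : ι → ℝ}
    (h : DiagonalizedBy S b μ) (k : ℕ) :
    ∃ B : (Fin (k + 1) → ι) → (hilbertPowSucc 𝕜 H k).carrier,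
      DiagonalizedBy (tensorPowSucc S k) B (fun f => ∏ j, μ (f j)) := by
  induction k with
  | zero =>
    refine ⟨b ∘ Equiv.funUnique (Fin 1) ι, ?_⟩
    have := h.reindex (Equiv.funUnique (Fin 1) ι)
    convert! this using 1
    ext f; simp
  | succ k ih =>
    obtain ⟨B, hB⟩ := ih
    have := (hB.tensor_completion h).reindex
      ((Equiv.prodComm _ _).trans (Fin.snocEquiv (fun _ : Fin (k + 2) => ι))).symm
    have hμ : (fun f : Fin (k + 2) → ι => ∏ j, μ (f j)) = (fun p => (∏ j, μ (p.1 j)) * μ p.2) ∘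
        ((Equiv.prodComm _ _).trans (Fin.snocEquiv (fun _ : Fin (k + 2) => ι))).symm := by
      ext f
      simp [Fin.prod_univ_castSucc, Fin.init]
    rw [hμ]
    exact ⟨_, this⟩

theorem DiagonalizedBy.tensorProblem {ι : Type*} {S : H →L[𝕜] G} {b : ι → H} {μ : ι → ℝ}
    (h : DiagonalizedBy S b μ) {d : ℕ} (hd : 1 ≤ d) :
    ∃ B : (Fin d → ι) → HilbertPow 𝕜 H d,
      DiagonalizedBy (tensorProblem S d) B (fun f => ∏ j, μ (f j)) := by
  obtain ⟨k, rfl⟩ : ∃ k, d = k + 1 := ⟨d - 1, by omega⟩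
  exact h.tensorPowSucc k

end TensorPowers

/-! ### Counting tuples with a large product -/

section Counting

variable {ι : Type*} {a : ι → ℝ}

theorem finite_lt_prod (ha0 : ∀ i, 0 ≤ a i) (ha1 : ∀ i, a i ≤ 1)
    (hfin : ∀ x, 0 < x → {i | x < a i}.Finite) (d : ℕ) {y : ℝ} (hy : 0 < y) :
    {f : Fin d → ι | y < ∏ j, a (f j)}.Finite := by
  refine (Set.Finite.pi' fun _ : Fin d => hfin y hy).subset fun f hf j => ?_
  refine (show y < ∏ j, a (f j) from hf).trans_le ?_
  rw [← Finset.mul_prod_erase _ _ (Finset.mem_univ j)]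
  exact mul_le_of_le_one_right (ha0 _) (Finset.prod_le_one (fun _ _ => ha0 _) fun _ _ => ha1 _)

/-- The `l`-th smallest factor of a product of `d` numbers in `[0, 1]` which exceeds `y` is larger
than `y ^ (1 / l)`, since the product of the `l` smallest factors exceeds `y`. -/
theorem rpow_lt_of_monotone {d : ℕ} {c : Fin d → ℝ} (hc0 : ∀ j, 0 ≤ c j) (hc1 : ∀ j, c j ≤ 1)
    (hmono : Monotone c) {y : ℝ} (hy : 0 < y) (hprod : y < ∏ j, c j) (l : Fin d) :
    y ^ (1 / ((l : ℝ) + 1)) < c l := by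
  have h1 : ∏ j, c j ≤ ∏ j ∈ Finset.Iic l, c j :=
    Finset.prod_le_prod_of_subset_of_le_one (Finset.subset_univ _) (fun j _ => hc0 j)
      fun j _ _ => hc1 j
  have h2 : ∏ j ∈ Finset.Iic l, c j ≤ c l ^ ((l : ℕ) + 1) := by
    refine (Finset.prod_le_prod (fun j _ => hc0 j)
      (fun j hj => hmono (Finset.mem_Iic.1 hj))).trans_eq ?_
    rw [Finset.prod_const, Fin.card_Iic]
  have h3 : y < c l ^ ((l : ℕ) + 1) := hprod.trans_le (h1.trans h2)
  have h4 := Real.rpow_lt_rpow hy.le h3 (z := 1 / ((l : ℝ) + 1)) (by positivity)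
  rw [← Real.rpow_natCast, ← Real.rpow_mul (hc0 l)] at h4
  have h5 : (((l : ℕ) + 1 : ℕ) : ℝ) * (1 / ((l : ℝ) + 1)) = 1 := by
    push_cast
    field_simp
  rwa [h5, Real.rpow_one] at h4

/-- A tuple with product larger than `y` is determined by the positions and the values of its `K`
smallest entries, provided that at most `K` entries are nontrivial. -/
theorem ncard_lt_prod_le (ha0 : ∀ i, 0 ≤ a i) (ha1 : ∀ i, a i ≤ 1)
    (hfin : ∀ x, 0 < x → {i | x < a i}.Finite) (i₀ : ι) {d K : ℕ} (hKd : K ≤ d) {y : ℝ}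
    (hy : 0 < y) (htriv : K < d → ∀ i, i ≠ i₀ → a i < 1)
    (hK : ∀ f : Fin d → ι, y < ∏ j, a (f j) → {j | a (f j) < 1}.ncard ≤ K) :
    {f : Fin d → ι | y < ∏ j, a (f j)}.ncard
      ≤ d ^ K * ∏ l ∈ Finset.range K, {i | y ^ (1 / ((l : ℝ) + 1)) < a i}.ncard := by
  classical
  have hB : ∀ l : Fin K, {i | y ^ (1 / ((l : ℝ) + 1)) < a i}.Finite :=
    fun l => hfin _ (Real.rpow_pos_of_pos hy _)
  let P : Finset ((Fin K → Fin d) × (Fin K → ι)) :=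
    Finset.univ ×ˢ Fintype.piFinset fun l => (hB l).toFinset
  let Φ : (Fin K → Fin d) × (Fin K → ι) → Fin d → ι := fun q j =>
    if h : ∃ l, q.1 l = j then q.2 h.choose else i₀
  have hsub : {f : Fin d → ι | y < ∏ j, a (f j)} ⊆ (P.image Φ : Finset (Fin d → ι)) := by
    intro f hf
    let σ := Tuple.sort (a ∘ f)
    have hmono : Monotone ((a ∘ f) ∘ σ) := Tuple.monotone_sort _
    have hprod : y < ∏ j, ((a ∘ f) ∘ σ) j := by
      have := Equiv.prod_comp σ (a ∘ f)
      exact (show y < ∏ j, a (f j) from hf).trans_eq this.symm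
    have hlow := rpow_lt_of_monotone (fun j => ha0 _) (fun j => ha1 _) hmono hy hprod
    rw [Finset.mem_coe, Finset.mem_image]
    refine ⟨(fun l => σ (Fin.castLE hKd l), fun l => f (σ (Fin.castLE hKd l))), ?_, ?_⟩
    · simp only [P, Finset.mem_product, Finset.mem_univ, true_and, Fintype.mem_piFinset,
        Set.Finite.mem_toFinset, Set.mem_ofPred_eq]
      exact fun l => hlow (Fin.castLE hKd l)
    · funext j
      by_cases h : ∃ l, σ (Fin.castLE hKd l) = j
      · simp only [Φ, dif_pos h]
        exact congrArg f h.choose_spec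
      · simp only [Φ, dif_neg h]
        by_contra hne
        -- otherwise the entry at `j` and the `K` smaller entries are all nontrivial
        have hl : K ≤ (σ.symm j : ℕ) := by
          by_contra! hlt
          exact h ⟨⟨_, hlt⟩, by simp [Fin.castLE]⟩
        have hj : a (f j) < 1 := htriv (hl.trans_lt (σ.symm j).2) _ (Ne.symm hne)
        have hcard : (σ '' (Finset.Iic (σ.symm j) : Finset (Fin d))).ncard
            ≤ {j | a (f j) < 1}.ncard := by
          refine Set.ncard_le_ncard ?_ (Set.toFinite _)
          rintro _ ⟨k, hk, rfl⟩
          have := hmono (Finset.mem_Iic.1 (Finset.mem_coe.1 hk))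
          simp only [Function.comp_apply, Equiv.apply_symm_apply] at this
          exact this.trans_lt hj
        rw [Set.ncard_image_of_injective _ σ.injective, Set.ncard_coe_finset, Fin.card_Iic] at hcard
        have := hK f hf
        omega
  calc {f : Fin d → ι | y < ∏ j, a (f j)}.ncard
      ≤ ((P.image Φ : Finset (Fin d → ι)) : Set (Fin d → ι)).ncard :=
        Set.ncard_le_ncard hsub (Finset.finite_toSet _)
    _ ≤ P.card := by rw [Set.ncard_coe_finset]; exact Finset.card_image_le
    _ = d ^ K * ∏ l ∈ Finset.range K, {i | y ^ (1 / ((l : ℝ) + 1)) < a i}.ncard := by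
        rw [Finset.card_product, Finset.card_univ, Fintype.card_fun, Fintype.card_fin,
          Fintype.card_fin, Fintype.card_piFinset, ← Fin.prod_univ_eq_prod_range
            (fun l => {i | y ^ (1 / ((l : ℝ) + 1)) < a i}.ncard) K]
        congr 1
        exact Finset.prod_congr rfl fun l _ => (Set.ncard_eq_toFinset_card _ (hB l)).symm

theorem log_ncard_lt_prod_le (ha0 : ∀ i, 0 ≤ a i) (ha1 : ∀ i, a i ≤ 1)
    (hfin : ∀ x, 0 < x → {i | x < a i}.Finite) (i₀ : ι) {d K : ℕ} (hKd : K ≤ d) {y : ℝ}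
    (hy : 0 < y) (htriv : K < d → ∀ i, i ≠ i₀ → a i < 1)
    (hK : ∀ f : Fin d → ι, y < ∏ j, a (f j) → {j | a (f j) < 1}.ncard ≤ K)
    (hne : ∃ f : Fin d → ι, y < ∏ j, a (f j)) :
    Real.log {f : Fin d → ι | y < ∏ j, a (f j)}.ncard
      ≤ K * Real.log d
        + ∑ l ∈ Finset.range K, Real.log {i | y ^ (1 / ((l : ℝ) + 1)) < a i}.ncard := by
  have hpos : 0 < {f : Fin d → ι | y < ∏ j, a (f j)}.ncard :=
    (Set.ncard_pos (finite_lt_prod ha0 ha1 hfin d hy)).2 hne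
  have hle := ncard_lt_prod_le ha0 ha1 hfin i₀ hKd hy htriv hK
  have h0 := hpos.trans_le hle
  have h1 : (d : ℝ) ^ K ≠ 0 := by exact_mod_cast (Nat.pos_of_mul_pos_right h0).ne'
  have h2 : ∀ l ∈ Finset.range K, ({i | y ^ (1 / ((l : ℝ) + 1)) < a i}.ncard : ℝ) ≠ 0 := by
    have := (Nat.pos_of_mul_pos_left h0).ne'
    rw [Finset.prod_ne_zero_iff] at this
    exact fun l hl => by exact_mod_cast this l hl
  rw [← Real.log_pow, ← Real.log_prod h2, ← Real.log_mul h1 (Finset.prod_ne_zero_iff.2 h2)]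
  refine Real.log_le_log (by exact_mod_cast hpos) ?_
  exact_mod_cast hle

/-- Filling up with a trivial entry turns `l`-tuples of entries larger than `y ^ (1 / l)` into
tuples with product larger than `y`. -/
theorem mul_log_ncard_le (ha0 : ∀ i, 0 ≤ a i) (ha1 : ∀ i, a i ≤ 1)
    (hfin : ∀ x, 0 < x → {i | x < a i}.Finite) {i₀ : ι} (hi₀ : a i₀ = 1) {d l : ℕ} (hl : 1 ≤ l)
    (hld : l ≤ d) {y : ℝ} (hy : 0 < y) (hy1 : y < 1) :
    l * Real.log {i | y ^ (1 / (l : ℝ)) < a i}.ncard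
      ≤ Real.log {f : Fin d → ι | y < ∏ j, a (f j)}.ncard := by
  classical
  obtain ⟨k, rfl⟩ := Nat.exists_eq_add_of_le hld
  have hx : 0 < y ^ (1 / (l : ℝ)) := Real.rpow_pos_of_pos hy _
  have hx1 : y ^ (1 / (l : ℝ)) < 1 := Real.rpow_lt_one hy.le hy1 (by positivity)
  have hxl : (y ^ (1 / (l : ℝ))) ^ l = y := by
    rw [one_div, Real.rpow_inv_natCast_pow hy.le (by omega)]
  obtain ⟨B, hB⟩ := (hfin _ hx).exists_finset_coe
  have hB' : ∀ i, i ∈ B ↔ y ^ (1 / (l : ℝ)) < a i := fun i => by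
    rw [← Finset.mem_coe, hB]; rfl
  have hBpos : 0 < B.card := Finset.card_pos.2 ⟨i₀, (hB' _).2 (by rwa [hi₀])⟩
  let Ψ : (Fin l → ι) → (Fin (l + k) → ι) := fun g => Fin.append g fun _ => i₀
  have hinj : Function.Injective Ψ := fun g g' h => by
    funext j
    simpa [Ψ] using congrFun h (Fin.castAdd k j)
  have hle : B.card ^ l ≤ {f : Fin (l + k) → ι | y < ∏ j, a (f j)}.ncard := by
    have h1 : ((Fintype.piFinset fun _ : Fin l => B).image Ψ).card = B.card ^ l := by
      rw [Finset.card_image_of_injective _ hinj, Fintype.card_piFinset_const]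
    rw [← h1, ← Set.ncard_coe_finset]
    refine Set.ncard_le_ncard ?_ (finite_lt_prod ha0 ha1 hfin _ hy)
    intro f hf
    obtain ⟨g, hg, rfl⟩ := Finset.mem_image.1 (Finset.mem_coe.1 hf)
    rw [Fintype.mem_piFinset] at hg
    show y < ∏ j, a (Ψ g j)
    rw [Fin.prod_univ_add]
    simp only [Ψ, Fin.append_left, Fin.append_right, hi₀, Finset.prod_const_one, mul_one]
    have : Nonempty (Fin l) := ⟨⟨0, hl⟩⟩
    calc y = ∏ _j : Fin l, y ^ (1 / (l : ℝ)) := by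
          rw [Finset.prod_const, Finset.card_univ, Fintype.card_fin, hxl]
      _ < ∏ j, a (g j) := Finset.prod_lt_prod_of_nonempty (fun _ _ => hx)
          (fun j _ => (hB' _).1 (hg j)) Finset.univ_nonempty
  rw [← hB, Set.ncard_coe_finset, ← Real.log_pow]
  refine Real.log_le_log (by positivity) ?_
  exact_mod_cast hle

/-- In a product larger than `y`, each nontrivial factor costs at least the factor `q < 1`. -/
theorem ncard_mul_log_inv_le (ha0 : ∀ i, 0 ≤ a i) (ha1 : ∀ i, a i ≤ 1) {q : ℝ}
    (hq : ∀ i, a i < 1 → a i ≤ q) {y : ℝ} (hy : 0 < y) {d : ℕ} {f : Fin d → ι}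
    (hf : y < ∏ j, a (f j)) : {j | a (f j) < 1}.ncard * Real.log q⁻¹ ≤ Real.log y⁻¹ := by
  classical
  have h1 : ∏ j, a (f j) ≤ q ^ {j | a (f j) < 1}.ncard := by
    rw [Set.ncard_eq_toFinset_card', Set.toFinset_ofPred]
    refine (Finset.prod_le_prod_of_subset_of_le_one
      (Finset.filter_subset (fun j => a (f j) < 1) _) (fun _ _ => ha0 _)
      fun j _ _ => ha1 _).trans ?_
    rw [← Finset.prod_const]
    exact Finset.prod_le_prod (fun _ _ => ha0 _) fun j hj => hq _ (Finset.mem_filter.1 hj).2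
  have h2 := Real.log_le_log hy (hf.le.trans h1)
  rw [Real.log_pow] at h2
  rw [Real.log_inv, Real.log_inv]
  linarith

end Counting

/-! ### Negligible quantities in the limit `ε⁻¹ + d → ∞` -/

section Negligible

open Asymptotics

theorem isLittleO_comp_of_tendsto_add {α : Type*} {l : Filter α} {X Y : α → ℝ}
    (hX : ∀ᶠ a in l, 1 ≤ X a) (hY : ∀ᶠ a in l, 1 ≤ Y a)
    (hXY : Tendsto (fun a => X a + Y a) l atTop) {s t : ℝ} (ht : 0 < t) {φ : ℝ → ℝ}
    (hφ : φ =o[atTop] fun x => x ^ s) (hmono : MonotoneOn φ (Set.Ici 1))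
    (h0 : ∀ x, 1 ≤ x → 0 ≤ φ x) :
    (fun a => φ (X a)) =o[l] fun a => X a ^ s + Y a ^ t := by
  rw [isLittleO_iff]
  intro c hc
  obtain ⟨R₁, hR₁⟩ := eventually_atTop.1
    (((isLittleO_iff.1 hφ) hc).and (eventually_ge_atTop (1 : ℝ)))
  obtain ⟨R₂, hR₂⟩ := eventually_atTop.1
    ((tendsto_rpow_atTop ht).eventually_ge_atTop (φ R₁ / c))
  filter_upwards [hX, hY, hXY.eventually_ge_atTop (R₁ + R₂)] with a ha1 ha2 ha3
  have hXs : 0 < X a ^ s := Real.rpow_pos_of_pos (by linarith) _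
  have hYt : 0 < Y a ^ t := Real.rpow_pos_of_pos (by linarith) _
  rw [Real.norm_of_nonneg (h0 _ ha1), Real.norm_of_nonneg (by positivity)]
  rcases le_total R₁ (X a) with h | h
  · have h2 := (hR₁ _ h).1
    rw [Real.norm_of_nonneg (h0 _ ha1), Real.norm_of_nonneg hXs.le] at h2
    nlinarith
  · have h2 := hR₂ (Y a) (by linarith)
    rw [div_le_iff₀ hc] at h2
    have h3 := hmono ha1 (hR₁ R₁ le_rfl).2 h
    nlinarith

theorem isLittleO_one_add_log {r : ℝ} (hr : 0 < r) :
    (fun x : ℝ => 1 + Real.log x) =o[atTop] fun x => x ^ r := by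
  refine IsLittleO.add ?_ (isLittleO_log_rpow_atTop hr)
  refine isLittleO_const_left.2 (Or.inr ?_)
  exact tendsto_norm_atTop_atTop.comp (tendsto_rpow_atTop hr)

theorem isLittleO_one_add_log_sq {r : ℝ} (hr : 0 < r) :
    (fun x : ℝ => (1 + Real.log x) ^ 2) =o[atTop] fun x => x ^ r := by
  refine ((isLittleO_one_add_log (half_pos hr)).pow two_pos).congr' EventuallyEq.rfl ?_
  filter_upwards [eventually_ge_atTop 0] with x hx
  rw [← Real.rpow_mul_natCast hx]
  congr 1
  push_cast
  ring

theorem isLittleO_mul_one_add_log {t : ℝ} (ht : 1 < t) :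
    (fun x : ℝ => x * (1 + Real.log x)) =o[atTop] fun x => x ^ t := by
  refine ((isBigO_refl (fun x : ℝ => x) atTop).mul_isLittleO
    (isLittleO_one_add_log (sub_pos.2 ht))).congr' EventuallyEq.rfl ?_
  filter_upwards [eventually_gt_atTop 0] with x hx
  rw [Real.rpow_sub_one hx.ne']
  field_simp

theorem one_le_one_add_log {x : ℝ} (hx : 1 ≤ x) : 1 ≤ 1 + Real.log x :=
  le_add_of_nonneg_right (Real.log_nonneg hx)

theorem monotoneOn_one_add_log : MonotoneOn (fun x : ℝ => 1 + Real.log x) (Set.Ici 1) :=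
  fun x hx _ _ hxy => by
    have : (1 : ℝ) ≤ x := hx
    have := Real.log_le_log (by linarith) hxy
    simpa using this

theorem monotoneOn_one_add_log_sq : MonotoneOn (fun x : ℝ => (1 + Real.log x) ^ 2) (Set.Ici 1) :=
  fun x hx _ hy hxy => by
    have h1 := monotoneOn_one_add_log hx hy hxy
    have h2 := one_le_one_add_log (x := x) hx
    exact pow_le_pow_left₀ (by linarith) h1 2

theorem monotoneOn_mul_one_add_log :
    MonotoneOn (fun x : ℝ => x * (1 + Real.log x)) (Set.Ici 1) :=
  fun x hx y hy hxy => by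
    have h1 := monotoneOn_one_add_log hx hy hxy
    have h2 := one_le_one_add_log (x := x) hx
    have h3 : (1 : ℝ) ≤ y := hy
    exact mul_le_mul hxy h1 (by linarith) (by linarith)

/-- The quantity `ε ^ (-s) + d ^ t` against which the information complexity is measured. -/
noncomputable def tractDenom (s t : ℝ) (p : ℝ × ℕ) : ℝ := p.1 ^ (-s) + (p.2 : ℝ) ^ t

variable {𝕜 : Type u} [RCLike 𝕜]
  {F : ℕ → Type v} [∀ d, NormedAddCommGroup (F d)] [∀ d, NormedSpace 𝕜 (F d)]
  {G : ℕ → Type w} [∀ d, NormedAddCommGroup (G d)] [∀ d, NormedSpace 𝕜 (G d)]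
  (S : ∀ d, F d →L[𝕜] G d)

theorem eventually_absLimit : ∀ᶠ p in absLimit S,
    0 < p.1 ∧ p.1 ≤ 1 ∧ 1 ≤ p.2 ∧ p.1 < minimalError (S p.2) 0 :=
  mem_inf_of_right (mem_principal_self _)

theorem tendsto_absLimit : Tendsto (fun p : ℝ × ℕ => p.1⁻¹ + (p.2 : ℝ)) (absLimit S) atTop :=
  tendsto_comap.mono_left inf_le_left

theorem tendsto_to_absLimit {α : Type*} {l : Filter α} {f : α → ℝ × ℕ}
    (h1 : Tendsto (fun a => (f a).1⁻¹ + ((f a).2 : ℝ)) l atTop)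
    (h2 : ∀ᶠ a in l, 0 < (f a).1 ∧ (f a).1 ≤ 1 ∧ 1 ≤ (f a).2 ∧
      (f a).1 < minimalError (S (f a).2) 0) : Tendsto f l (absLimit S) :=
  tendsto_inf.2 ⟨tendsto_comap_iff.2 h1, tendsto_principal.2 h2⟩

theorem tractDenom_pos {s t : ℝ} {p : ℝ × ℕ} (h1 : 0 < p.1) (h2 : 1 ≤ p.2) :
    0 < tractDenom s t p := by
  have : (0 : ℝ) < p.2 := by exact_mod_cast h2
  unfold tractDenom
  positivity

theorem tendsto_div_tractDenom_iff {s t : ℝ} {f : ℝ × ℕ → ℝ} :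
    Tendsto (fun p : ℝ × ℕ => f p / (p.1 ^ (-s) + (p.2 : ℝ) ^ t)) (absLimit S) (𝓝 0) ↔
      f =o[absLimit S] tractDenom s t := by
  refine (isLittleO_iff_tendsto' (f := f) (g := tractDenom s t) ?_).symm
  filter_upwards [eventually_absLimit S] with p hp h0
  exact absurd h0 (tractDenom_pos hp.1 hp.2.2.1).ne'

theorem isWeaklyTractable_iff {s t : ℝ} : IsWeaklyTractable S s t ↔
    (fun p : ℝ × ℕ => Real.log (absComplexity p.1 (S p.2))) =o[absLimit S] tractDenom s t :=
  tendsto_div_tractDenom_iff S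

theorem isLittleO_of_le {s t : ℝ} {f g : ℝ × ℕ → ℝ} (hg : g =o[absLimit S] tractDenom s t)
    (hfg : ∀ᶠ p in absLimit S, 0 ≤ f p ∧ f p ≤ g p) : f =o[absLimit S] tractDenom s t := by
  refine IsBigO.trans_isLittleO (IsBigO.of_bound 1 ?_) hg
  filter_upwards [hfg] with p hp
  rw [one_mul, Real.norm_of_nonneg hp.1]
  exact hp.2.trans (le_abs_self _)

theorem isLittleO_comp_inv {s t : ℝ} (ht : 0 < t) {φ : ℝ → ℝ}
    (hφ : φ =o[atTop] fun x => x ^ s) (hmono : MonotoneOn φ (Set.Ici 1))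
    (h0 : ∀ x, 1 ≤ x → 0 ≤ φ x) :
    (fun p : ℝ × ℕ => φ p.1⁻¹) =o[absLimit S] tractDenom s t := by
  refine (isLittleO_comp_of_tendsto_add (l := absLimit S) (X := fun p => p.1⁻¹)
    (Y := fun p => (p.2 : ℝ)) ?_ ?_ (tendsto_absLimit S) ht hφ hmono h0).congr'
    EventuallyEq.rfl ?_
  · filter_upwards [eventually_absLimit S] with p hp
    exact (one_le_inv₀ hp.1).2 hp.2.1
  · filter_upwards [eventually_absLimit S] with p hp
    exact_mod_cast hp.2.2.1
  · filter_upwards [eventually_absLimit S] with p hp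
    rw [tractDenom, Real.rpow_neg hp.1.le, Real.inv_rpow hp.1.le]

theorem isLittleO_comp_snd {s t : ℝ} (hs : 0 < s) {φ : ℝ → ℝ}
    (hφ : φ =o[atTop] fun x => x ^ t) (hmono : MonotoneOn φ (Set.Ici 1))
    (h0 : ∀ x, 1 ≤ x → 0 ≤ φ x) :
    (fun p : ℝ × ℕ => φ p.2) =o[absLimit S] tractDenom s t := by
  refine (isLittleO_comp_of_tendsto_add (l := absLimit S) (X := fun p => (p.2 : ℝ))
    (Y := fun p => p.1⁻¹) ?_ ?_ ?_ hs hφ hmono h0).congr' EventuallyEq.rfl ?_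
  · filter_upwards [eventually_absLimit S] with p hp
    exact_mod_cast hp.2.2.1
  · filter_upwards [eventually_absLimit S] with p hp
    exact (one_le_inv₀ hp.1).2 hp.2.1
  · exact (tendsto_absLimit S).congr fun p => add_comm _ _
  · filter_upwards [eventually_absLimit S] with p hp
    rw [tractDenom, Real.rpow_neg hp.1.le, Real.inv_rpow hp.1.le, add_comm]

theorem isLittleO_one_add_log_snd_sq {s t : ℝ} (hs : 0 < s) (ht : 0 < t) :
    (fun p : ℝ × ℕ => (1 + Real.log p.2) ^ 2) =o[absLimit S] tractDenom s t :=
  isLittleO_comp_snd S hs (isLittleO_one_add_log_sq ht) monotoneOn_one_add_log_sq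
    fun _ _ => sq_nonneg _

theorem isLittleO_snd_mul_one_add_log {s t : ℝ} (hs : 0 < s) (ht : 1 < t) :
    (fun p : ℝ × ℕ => (p.2 : ℝ) * (1 + Real.log p.2)) =o[absLimit S] tractDenom s t :=
  isLittleO_comp_snd S hs (isLittleO_mul_one_add_log ht) monotoneOn_mul_one_add_log
    fun x hx => mul_nonneg (by linarith) (zero_le_one.trans (one_le_one_add_log hx))

/-- A number of coordinates of the order `ln ε⁻¹` contributes negligibly. -/
theorem isLittleO_mul_one_add_log_of_le {s t : ℝ} (hs : 0 < s) (ht : 0 < t) {k : ℝ × ℕ → ℕ}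
    {C : ℝ} (hC : 0 ≤ C)
    (hk : ∀ᶠ p in absLimit S, (k p : ℝ) ≤ C * Real.log p.1⁻¹) :
    (fun p : ℝ × ℕ => (k p : ℝ) * (1 + Real.log p.2)) =o[absLimit S] tractDenom s t := by
  have h1 : (fun p : ℝ × ℕ => (1 + Real.log p.1⁻¹) ^ 2) =o[absLimit S] tractDenom s t :=
    isLittleO_comp_inv S ht (isLittleO_one_add_log_sq hs) monotoneOn_one_add_log_sq
      fun _ _ => sq_nonneg _
  refine isLittleO_of_le S
    ((h1.add (isLittleO_one_add_log_snd_sq S hs ht)).const_mul_left C) ?_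
  filter_upwards [eventually_absLimit S, hk] with p hp hkp
  have h2 := one_le_one_add_log (x := (p.2 : ℝ)) (by exact_mod_cast hp.2.2.1)
  have h3 := one_le_one_add_log ((one_le_inv₀ hp.1).2 hp.2.1)
  refine ⟨by positivity, ?_⟩
  calc (k p : ℝ) * (1 + Real.log p.2)
      ≤ (C * (1 + Real.log p.1⁻¹)) * (1 + Real.log p.2) := by
        refine mul_le_mul_of_nonneg_right (hkp.trans ?_) (by linarith)
        exact mul_le_mul_of_nonneg_left (by linarith) hC
    _ ≤ C * ((1 + Real.log p.1⁻¹) ^ 2 + (1 + Real.log p.2) ^ 2) := by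
        rw [mul_assoc]
        refine mul_le_mul_of_nonneg_left ?_ hC
        nlinarith [sq_nonneg ((1 + Real.log p.1⁻¹) - (1 + Real.log p.2)),
          sq_nonneg (1 + Real.log p.1⁻¹), sq_nonneg (1 + Real.log p.2)]

theorem sum_inv_range_le (k : ℕ) :
    ∑ l ∈ Finset.range k, ((l : ℝ) + 1)⁻¹ ≤ 1 + Real.log k := by
  have := harmonic_le_one_add_log k
  rw [harmonic] at this
  push_cast at this
  exact this

/-- Only the first root of `X` is of the order of `X`: the remaining ones are bounded, by
Bernoulli's inequality for `√X`, through a harmonic sum. -/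
theorem sum_rpow_inv_le {X : ℝ} (hX : 1 ≤ X) (k : ℕ) :
    ∑ l ∈ Finset.range k, X ^ (1 / ((l : ℝ) + 1)) ≤ X + k + 2 * √X * (1 + Real.log k) := by
  have hterm : ∀ l ∈ Finset.range k, X ^ (1 / ((l : ℝ) + 1))
      ≤ (if l = 0 then X else 0) + 1 + 2 * √X * ((l : ℝ) + 1)⁻¹ := by
    intro l _
    have hpos : 0 ≤ 2 * √X * ((l : ℝ) + 1)⁻¹ := by positivity
    split_ifs with hl
    · subst hl
      simp only [Nat.cast_zero, zero_add, div_one, Real.rpow_one] at hpos ⊢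
      linarith
    · have hl1 : (1 : ℝ) ≤ l := by exact_mod_cast Nat.one_le_iff_ne_zero.2 hl
      have h1 : X ^ (1 / ((l : ℝ) + 1)) = (1 + (√X - 1)) ^ (2 * ((l : ℝ) + 1)⁻¹) := by
        rw [add_sub_cancel, Real.sqrt_eq_rpow, ← Real.rpow_mul (by linarith)]
        congr 1
        ring
      rw [h1]
      refine (rpow_one_add_le_one_add_mul_self (by linarith [Real.sqrt_nonneg X])
        (by positivity) ?_).trans ?_
      · rw [← div_eq_mul_inv, div_le_one (by positivity)]; linarith
      · have : (0 : ℝ) < ((l : ℝ) + 1)⁻¹ := by positivity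
        nlinarith
  refine (Finset.sum_le_sum hterm).trans ?_
  rw [Finset.sum_add_distrib, Finset.sum_add_distrib, ← Finset.mul_sum]
  have h1 : ∑ l ∈ Finset.range k, (if l = 0 then X else 0) ≤ X := by
    rw [Finset.sum_ite_eq']
    split_ifs <;> linarith
  have h2 := mul_le_mul_of_nonneg_left (sum_inv_range_le k)
    (show 0 ≤ 2 * √X by positivity)
  simp only [Finset.sum_const, Finset.card_range, nsmul_eq_mul, mul_one]
  linarith

end Negligible

/-! ### Decay of the eigenvalues and the counting function -/

section Problem

open Asymptotics

variable {𝕜 : Type u} [RCLike 𝕜]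
  {H : Type v} [NormedAddCommGroup H] [InnerProductSpace 𝕜 H] [CompleteSpace H]
  {G : Type w} [NormedAddCommGroup G] [InnerProductSpace 𝕜 G] [CompleteSpace G]
  {ι : Type*} {S : H →L[𝕜] G} {b : ι → H} {μ : ι → ℝ}

theorem ncard_fin_le {d : ℕ} (s : Set (Fin d)) : s.ncard ≤ d := by
  refine (Set.ncard_le_ncard (Set.subset_univ s) Set.finite_univ).trans_eq ?_
  simp [Set.ncard_univ]

theorem eigenvalueSeq_nonneg (S : H →L[𝕜] G) (n : ℕ) : 0 ≤ eigenvalueSeq S n :=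
  Real.sSup_nonneg fun _ hx => hx.1.le

namespace DiagonalizedBy

theorem eigenvalueSeq_one_pos (h : DiagonalizedBy S b μ)
    (hc : ∀ x, 0 < x → {i | x < μ i}.Finite) (h2 : 0 < eigenvalueSeq S 2) :
    0 < eigenvalueSeq S 1 := by
  have h3 := (h.lt_eigenvalueSeq_iff hc (half_pos h2) one_le_two).1 (half_lt_self h2)
  exact (half_pos h2).trans
    ((h.lt_eigenvalueSeq_iff hc (half_pos h2) le_rfl).2 (one_le_two.trans h3))

theorem le_eigenvalueSeq_one (h : DiagonalizedBy S b μ)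
    (hc : ∀ x, 0 < x → {i | x < μ i}.Finite) (h1 : 0 < eigenvalueSeq S 1) (i : ι) :
    μ i ≤ eigenvalueSeq S 1 := by
  by_contra! hlt
  exact lt_irrefl _ ((h.lt_eigenvalueSeq_iff hc h1 le_rfl).2
    ((Set.ncard_pos (hc _ h1)).2 ⟨i, hlt⟩))

theorem exists_eq_eigenvalueSeq_one (h : DiagonalizedBy S b μ)
    (hc : ∀ x, 0 < x → {i | x < μ i}.Finite) (h1 : 0 < eigenvalueSeq S 1) :
    ∃ i, μ i = eigenvalueSeq S 1 := by
  have hfin := hc _ (half_pos h1)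
  have hpos := (h.lt_eigenvalueSeq_iff hc (half_pos h1) le_rfl).1 (half_lt_self h1)
  obtain ⟨i, hi, hmax⟩ := Set.exists_max_image _ μ hfin ((Set.ncard_pos hfin).1 hpos)
  have hi' : eigenvalueSeq S 1 / 2 < μ i := hi
  have hi0 : 0 < μ i := (half_pos h1).trans hi'
  refine ⟨i, le_antisymm (h.le_eigenvalueSeq_one hc h1 i) ?_⟩
  by_contra! hlt
  obtain ⟨j, hj⟩ := (Set.ncard_pos (hc _ hi0)).1 ((h.lt_eigenvalueSeq_iff hc hi0 le_rfl).1 hlt)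
  have hj' : μ i < μ j := hj
  exact (hmax j (hi'.trans hj')).not_gt hj'

theorem exists_ne_pos (h : DiagonalizedBy S b μ) (hc : ∀ x, 0 < x → {i | x < μ i}.Finite)
    (h2 : 0 < eigenvalueSeq S 2) (i₀ : ι) : ∃ i, i ≠ i₀ ∧ 0 < μ i := by
  have h3 := (h.lt_eigenvalueSeq_iff hc (half_pos h2) one_le_two).1 (half_lt_self h2)
  obtain ⟨i, hi, hne⟩ := Set.exists_ne_of_one_lt_ncard h3 i₀
  exact ⟨i, hne, (half_pos h2).trans hi⟩

/-- Inverting `λ_n = o((ln n) ^ (-2 / s))`: the logarithm of the number of eigenvalues above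
`x ^ 2` is `o(x ^ (-s))`. -/
theorem log_ncard_le_of_logDecay (h : DiagonalizedBy S b μ)
    (hc : ∀ x, 0 < x → {i | x < μ i}.Finite) {s : ℝ} (hs : 0 < s) (hdec : LogDecay S s)
    {η : ℝ} (hη : 0 < η) : ∃ C, 0 ≤ C ∧ ∀ x, 0 < x →
      Real.log {i | x ^ 2 < μ i}.ncard ≤ η * x ^ (-s) + C := by
  have hθ : 0 < η ^ (2 / s) := Real.rpow_pos_of_pos hη _
  obtain ⟨N, hN⟩ := eventually_atTop.1
    ((hdec.eventually_lt_const hθ).and (eventually_ge_atTop 2))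
  have hN2 : 2 ≤ N := (hN N le_rfl).2
  refine ⟨Real.log N, Real.log_natCast_nonneg _, fun x hx => ?_⟩
  set n := {i | x ^ 2 < μ i}.ncard with hn
  have hxs : 0 < x ^ (-s) := Real.rpow_pos_of_pos hx _
  rcases lt_or_ge n N with hlt | hge
  · have : Real.log n ≤ Real.log N := by
      rcases Nat.eq_zero_or_pos n with h0 | h0
      · rw [h0, Nat.cast_zero, Real.log_zero]; exact Real.log_natCast_nonneg _
      · exact Real.log_le_log (by exact_mod_cast h0) (by exact_mod_cast hlt.le)
    nlinarith
  · have h1 : x ^ 2 < eigenvalueSeq S n :=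
      (h.lt_eigenvalueSeq_iff hc (by positivity) (by omega)).2 hn.le
    have hlog : 0 < Real.log n := Real.log_pos (by exact_mod_cast (show 1 < n by omega))
    have h2 := (hN n hge).1
    have hpow : 0 < Real.log n ^ (-(2 / s)) := Real.rpow_pos_of_pos hlog _
    rw [div_lt_iff₀ hpow] at h2
    have h3 := (h1.trans h2).le
    -- raise `x ^ 2 ≤ η ^ (2 / s) * (log n) ^ (-2 / s)` to the power `s / 2`
    have h4 := Real.rpow_le_rpow (by positivity) h3 (z := s / 2) (by positivity)
    rw [Real.mul_rpow hθ.le hpow.le, ← Real.rpow_natCast, ← Real.rpow_mul hx.le,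
      ← Real.rpow_mul hη.le, ← Real.rpow_mul hlog.le] at h4
    have e1 : ((2 : ℕ) : ℝ) * (s / 2) = s := by push_cast; ring
    have e2 : 2 / s * (s / 2) = 1 := by field_simp
    have e3 : -(2 / s) * (s / 2) = -1 := by rw [neg_mul, e2]
    rw [e1, e2, e3, Real.rpow_one, Real.rpow_neg_one] at h4
    have h5 : Real.log n ≤ η * x ^ (-s) := by
      rw [Real.rpow_neg hx.le, ← div_eq_mul_inv, le_div_iff₀ (Real.rpow_pos_of_pos hx _)]
      rwa [← div_eq_mul_inv, le_div_iff₀ hlog, mul_comm] at h4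
    have := Real.log_natCast_nonneg N
    linarith

/-! ### The information complexity of the tensor product problem -/

theorem setOf_lt_prod_eq {c : ℝ} (hc : 0 < c) (d : ℕ) (y : ℝ) :
    {f : Fin d → ι | y < ∏ j, μ (f j)} = {f : Fin d → ι | y / c ^ d < ∏ j, μ (f j) / c} := by
  ext f
  simp only [Set.mem_ofPred_eq, Finset.prod_div_distrib, Finset.prod_const, Finset.card_univ,
    Fintype.card_fin]
  rw [div_lt_div_iff_of_pos_right (pow_pos hc d)]

theorem finite_lt_div (hc : ∀ x, 0 < x → {i | x < μ i}.Finite) {c : ℝ} (hcpos : 0 < c) (x : ℝ)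
    (hx : 0 < x) : {i | x < μ i / c}.Finite :=
  (hc (x * c) (by positivity)).subset fun i (hi : x < μ i / c) => (lt_div_iff₀ hcpos).1 hi

theorem finite_lt_prod_eigenvalues (h : DiagonalizedBy S b μ)
    (hc : ∀ x, 0 < x → {i | x < μ i}.Finite) (h1 : 0 < eigenvalueSeq S 1) (d : ℕ) {y : ℝ}
    (hy : 0 < y) : {f : Fin d → ι | y < ∏ j, μ (f j)}.Finite := by
  rw [setOf_lt_prod_eq h1]
  exact finite_lt_prod (fun i => div_nonneg (h.nonneg i) h1.le)
    (fun i => div_le_one_of_le₀ (h.le_eigenvalueSeq_one hc h1 i) h1.le)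
    (finite_lt_div hc h1) d (by positivity)

/-- The information complexity in dimension `d` counts the tuples of eigenvalues whose product
exceeds `ε ^ 2`. -/
theorem absComplexity_tensorProblem (h : DiagonalizedBy S b μ)
    (hc : ∀ x, 0 < x → {i | x < μ i}.Finite) (h1 : 0 < eigenvalueSeq S 1) {d : ℕ} (hd : 1 ≤ d)
    {ε : ℝ} (hε : 0 < ε) : absComplexity ε (_root_.tensorProblem S d)
      = {f : Fin d → ι | ε ^ 2 < ∏ j, μ (f j)}.ncard := by
  obtain ⟨B, hB⟩ := h.tensorProblem hd
  exact hB.absComplexity_eq hε.le (h.finite_lt_prod_eigenvalues hc h1 d (by positivity))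

theorem lt_minimalError_tensorProblem_iff (h : DiagonalizedBy S b μ)
    (hc : ∀ x, 0 < x → {i | x < μ i}.Finite) (h1 : 0 < eigenvalueSeq S 1) {d : ℕ} (hd : 1 ≤ d)
    {ε : ℝ} (hε : 0 < ε) :
    ε < minimalError (_root_.tensorProblem S d) 0 ↔ ε ^ 2 < eigenvalueSeq S 1 ^ d := by
  obtain ⟨B, hB⟩ := h.tensorProblem hd
  rw [hB.lt_minimalError_zero_iff hε.le (h.finite_lt_prod_eigenvalues hc h1 d (by positivity))]
  obtain ⟨i₀, hi₀⟩ := h.exists_eq_eigenvalueSeq_one hc h1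
  constructor
  · rintro ⟨f, hf⟩
    refine hf.trans_le ((Finset.prod_le_prod (fun j _ => h.nonneg _)
      fun j _ => h.le_eigenvalueSeq_one hc h1 (f j)).trans_eq ?_)
    simp
  · intro hlt
    exact ⟨fun _ => i₀, by simpa [hi₀] using hlt⟩

theorem absComplexity_rescaledOp (h : DiagonalizedBy S b μ)
    (hc : ∀ x, 0 < x → {i | x < μ i}.Finite) (h1 : 0 < eigenvalueSeq S 1) {x : ℝ} (hx : 0 < x) :
    absComplexity x (rescaledOp S) = {i | x ^ 2 < μ i / eigenvalueSeq S 1}.ncard := by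
  have h2 : DiagonalizedBy (rescaledOp S) b (fun i => μ i / eigenvalueSeq S 1) := by
    have e : (fun i => μ i / eigenvalueSeq S 1)
        = fun i => ((√(eigenvalueSeq S 1))⁻¹) ^ 2 * μ i := by
      funext i
      rw [inv_pow, Real.sq_sqrt h1.le, inv_mul_eq_div]
    rw [e]
    exact h.smul _
  exact h2.absComplexity_eq hx.le (finite_lt_div hc h1 _ (by positivity))

/-- Lower bound for the information complexity by that of the rescaled univariate problem. -/
theorem mul_log_ncard_le_log_absComplexity (h : DiagonalizedBy S b μ)
    (hc : ∀ x, 0 < x → {i | x < μ i}.Finite) (h1 : 0 < eigenvalueSeq S 1) {d l : ℕ} (hl : 1 ≤ l)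
    (hld : l ≤ d) {ε : ℝ} (hε : 0 < ε) (hεd : ε ^ 2 < eigenvalueSeq S 1 ^ d) :
    l * Real.log {i | (ε ^ 2 / eigenvalueSeq S 1 ^ d) ^ (1 / (l : ℝ))
        < μ i / eigenvalueSeq S 1}.ncard
      ≤ Real.log (absComplexity ε (_root_.tensorProblem S d)) := by
  obtain ⟨i₀, hi₀⟩ := h.exists_eq_eigenvalueSeq_one hc h1
  rw [h.absComplexity_tensorProblem hc h1 (hl.trans hld) hε, setOf_lt_prod_eq h1]
  exact mul_log_ncard_le (fun i => div_nonneg (h.nonneg i) h1.le)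
    (fun i => div_le_one_of_le₀ (h.le_eigenvalueSeq_one hc h1 i) h1.le)
    (finite_lt_div hc h1) (i₀ := i₀) (by rw [hi₀, div_self h1.ne']) hl hld (by positivity)
    ((div_lt_one (pow_pos h1 d)).2 hεd)

/-! ### Necessary conditions -/

/-- The univariate slice `d = 1` forces the decay of the eigenvalues. -/
theorem logDecay_of_isWeaklyTractable (h : DiagonalizedBy S b μ)
    (hc : ∀ x, 0 < x → {i | x < μ i}.Finite) (h1 : 0 < eigenvalueSeq S 1) {s t : ℝ} (hs : 0 < s)
    (hwt : IsWeaklyTractable (_root_.tensorProblem S) s t) : LogDecay S s := by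
  have hslice : Tendsto (fun ε : ℝ => (ε, 1)) (𝓝[>] 0) (absLimit (_root_.tensorProblem S)) := by
    refine tendsto_to_absLimit _
      (tendsto_atTop_add_const_right _ ((1 : ℕ) : ℝ) tendsto_inv_nhdsGT_zero) ?_
    have hpos : 0 < min 1 (√(eigenvalueSeq S 1)) := lt_min one_pos (Real.sqrt_pos.2 h1)
    filter_upwards [Ioo_mem_nhdsGT hpos] with ε hε
    refine ⟨hε.1, hε.2.le.trans (min_le_left _ _), le_rfl, ?_⟩
    rw [h.lt_minimalError_tensorProblem_iff hc h1 le_rfl hε.1, pow_one]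
    exact (Real.lt_sqrt hε.1.le).1 (hε.2.trans_le (min_le_right _ _))
  have hlim := ((isWeaklyTractable_iff _).1 hwt).comp_tendsto hslice
  refine tendsto_order.2 ⟨fun c hcneg => Eventually.of_forall fun n => hcneg.trans_le
    (div_nonneg (eigenvalueSeq_nonneg S n)
      (Real.rpow_nonneg (Real.log_natCast_nonneg n) _)), fun c hcpos => ?_⟩
  set c' : ℝ := c / 2 with hc'
  have hc'pos : 0 < c' := half_pos hcpos
  -- the constant is chosen such that `2 * η * c' ^ (-s / 2) < 1`
  set η : ℝ := c' ^ (s / 2) / 4 with hη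
  have hcs : 0 < c' ^ (s / 2) := Real.rpow_pos_of_pos hc'pos _
  have hsmall : ∀ᶠ ε : ℝ in 𝓝[>] 0,
      Real.log {i | ε ^ 2 < μ i}.ncard ≤ 2 * η * ε ^ (-s) := by
    filter_upwards [isLittleO_iff.1 hlim (show 0 < η by positivity),
      Ioo_mem_nhdsGT one_pos] with ε hε hε01
    have hset : absComplexity ε (_root_.tensorProblem S 1) = {i | ε ^ 2 < μ i}.ncard :=
      h.absComplexity_eq (T := S) hε01.1.le (hc _ (pow_pos hε01.1 2))
    have hge : 1 ≤ ε ^ (-s) := Real.one_le_rpow_of_pos_of_le_one_of_nonpos hε01.1 hε01.2.le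
      (by linarith)
    simp only [Function.comp_apply, tractDenom, hset, Nat.cast_one, Real.one_rpow] at hε
    rw [Real.norm_of_nonneg (Real.log_natCast_nonneg _),
      Real.norm_of_nonneg (by linarith)] at hε
    nlinarith
  have hx : Tendsto (fun n : ℕ => √(c' * Real.log n ^ (-(2 / s)))) atTop (𝓝[>] 0) := by
    refine tendsto_nhdsWithin_iff.2 ⟨?_, ?_⟩
    · have h2 : Tendsto (fun n : ℕ => Real.log n ^ (-(2 / s))) atTop (𝓝 0) :=
        (tendsto_rpow_neg_atTop (by positivity)).comp
          (Real.tendsto_log_atTop.comp tendsto_natCast_atTop_atTop)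
      simpa using (h2.const_mul c').sqrt
    · filter_upwards [eventually_ge_atTop 2] with n hn
      have : 0 < Real.log n := Real.log_pos (by exact_mod_cast hn)
      exact Real.sqrt_pos.2 (by positivity)
  filter_upwards [hx.eventually hsmall, eventually_ge_atTop 2] with n hn hn2
  have hlog : 0 < Real.log n := Real.log_pos (by exact_mod_cast hn2)
  have hpow : 0 < Real.log n ^ (-(2 / s)) := Real.rpow_pos_of_pos hlog _
  rw [div_lt_iff₀ hpow]
  by_contra! hle
  rw [Real.sq_sqrt (by positivity)] at hn
  have hlt : c' * Real.log n ^ (-(2 / s)) < eigenvalueSeq S n := by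
    have := mul_pos hc'pos hpow
    rw [hc'] at this ⊢
    linarith
  have hcard := (h.lt_eigenvalueSeq_iff hc (by positivity) (by omega)).1 hlt
  have hge : Real.log n ≤ Real.log {i | c' * Real.log n ^ (-(2 / s)) < μ i}.ncard :=
    Real.log_le_log (by positivity) (by exact_mod_cast hcard)
  have hval : √(c' * Real.log n ^ (-(2 / s))) ^ (-s) = (c' ^ (s / 2))⁻¹ * Real.log n := by
    rw [Real.sqrt_eq_rpow, ← Real.rpow_mul (by positivity), Real.mul_rpow hc'pos.le hpow.le,
      ← Real.rpow_mul hlog.le, ← Real.rpow_neg hc'pos.le]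
    have e1 : 1 / 2 * -s = -(s / 2) := by ring
    have e2 : -(2 / s) * -(s / 2) = 1 := by field_simp
    rw [e1, e2, Real.rpow_one]
  have hhalf : 2 * η * ((c' ^ (s / 2))⁻¹ * Real.log n) = Real.log n / 2 := by
    rw [hη]; field_simp; norm_num
  rw [hval, hhalf] at hn
  linarith

/-- Exponentially many tuples at a fixed accuracy force `1 < t`. -/
theorem one_lt_of_isWeaklyTractable {s t : ℝ}
    (hwt : IsWeaklyTractable (_root_.tensorProblem S) s t) {ε : ℝ} (hε : 0 < ε) (hε1 : ε ≤ 1)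
    {q : ℕ} (hq : 1 ≤ q)
    (hlow : ∀ k : ℕ, 1 ≤ k → ε < minimalError (_root_.tensorProblem S (q * k)) 0 ∧
      k * Real.log 2 ≤ Real.log (absComplexity ε (_root_.tensorProblem S (q * k)))) : 1 < t := by
  by_contra! ht
  have hseq : Tendsto (fun k : ℕ => (ε, q * k)) atTop (absLimit (_root_.tensorProblem S)) := by
    refine tendsto_to_absLimit _
      (tendsto_atTop_add_const_left _ ε⁻¹ (f := fun k => ((q * k : ℕ) : ℝ)) ?_) ?_
    · exact tendsto_natCast_atTop_atTop.comp (tendsto_id.const_mul_atTop' hq)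
    · filter_upwards [eventually_ge_atTop 1] with k hk
      exact ⟨hε, hε1, Nat.mul_pos hq hk, (hlow k hk).1⟩
  have hlim := ((isWeaklyTractable_iff _).1 hwt).comp_tendsto hseq
  have hεs : 0 < ε ^ (-s) := Real.rpow_pos_of_pos hε _
  set c : ℝ := Real.log 2 / (2 * (ε ^ (-s) + q)) with hcdef
  have hlog2 : 0 < Real.log 2 := Real.log_pos one_lt_two
  have hc : 0 < c := by positivity
  obtain ⟨k, hk, hk1⟩ := ((isLittleO_iff.1 hlim hc).and (eventually_ge_atTop 1)).exists
  simp only [Function.comp_apply, tractDenom] at hk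
  have hk1' : (1 : ℝ) ≤ k := by exact_mod_cast hk1
  have hqk : (1 : ℝ) ≤ ((q * k : ℕ) : ℝ) := by exact_mod_cast Nat.mul_pos hq hk1
  have hpow : ((q * k : ℕ) : ℝ) ^ t ≤ q * k := by
    refine (Real.rpow_le_rpow_of_exponent_le hqk ht).trans_eq ?_
    rw [Real.rpow_one, Nat.cast_mul]
  rw [Real.norm_of_nonneg (Real.log_natCast_nonneg _), Real.norm_of_nonneg (by positivity)] at hk
  have h1 := (hlow k hk1).2.trans hk
  have h2 : c * (ε ^ (-s) + ((q * k : ℕ) : ℝ) ^ t) ≤ c * ((ε ^ (-s) + q) * k) := by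
    refine mul_le_mul_of_nonneg_left ?_ hc.le
    nlinarith
  have h3 : c * ((ε ^ (-s) + q) * k) = k * Real.log 2 / 2 := by
    rw [hcdef]; field_simp
  have h4 : 0 < k * Real.log 2 := by positivity
  linarith

/-! ### Sufficient conditions -/

/-- Upper bound when no eigenvalue exceeds `1`: it suffices that the number `k` of nontrivial
coordinates is negligible up to a logarithmic factor. -/
theorem isWeaklyTractable_of_logDecay (h : DiagonalizedBy S b μ)
    (hc : ∀ x, 0 < x → {i | x < μ i}.Finite) (h1 : 0 < eigenvalueSeq S 1)
    (hle : eigenvalueSeq S 1 ≤ 1) {s t : ℝ} (hs : 0 < s) (ht : 0 < t) (hdec : LogDecay S s)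
    (i₀ : ι) (k : ℝ × ℕ → ℕ)
    (hk : ∀ᶠ p in absLimit (_root_.tensorProblem S), k p ≤ p.2 ∧
      (k p < p.2 → ∀ i, i ≠ i₀ → μ i < 1) ∧
      ∀ f : Fin p.2 → ι, p.1 ^ 2 < ∏ j, μ (f j) → {j | μ (f j) < 1}.ncard ≤ k p)
    (hko : (fun p : ℝ × ℕ => (k p : ℝ) * (1 + Real.log p.2))
      =o[absLimit (_root_.tensorProblem S)] tractDenom s t) :
    IsWeaklyTractable (_root_.tensorProblem S) s t := by
  rw [isWeaklyTractable_iff, isLittleO_iff]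
  intro c hcpos
  set η : ℝ := c / 4 with hη
  have hηpos : 0 < η := by positivity
  obtain ⟨C, hC, hcount⟩ := h.log_ncard_le_of_logDecay hc hs hdec hηpos
  have hrest := ((isLittleO_one_add_log_snd_sq (_root_.tensorProblem S) hs ht).const_mul_left
    η).add (hko.const_mul_left (1 + η + C))
  filter_upwards [eventually_absLimit _, hk, isLittleO_iff.1 hrest (half_pos hcpos)]
    with p hp hkp hrp
  obtain ⟨hε, hε1, hd, hinit⟩ := hp
  obtain ⟨hkd, htriv, hnum⟩ := hkp
  have hD := tractDenom_pos (s := s) (t := t) hε hd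
  have hd1 : (1 : ℝ) ≤ p.2 := by exact_mod_cast hd
  set w : ℝ := 1 + Real.log p.2 with hw
  have hw1 : 1 ≤ w := one_le_one_add_log hd1
  rw [Real.norm_of_nonneg hD.le, Real.norm_of_nonneg (by positivity)] at hrp
  rw [Real.norm_of_nonneg (Real.log_natCast_nonneg _), Real.norm_of_nonneg hD.le]
  have hne : ∃ f : Fin p.2 → ι, p.1 ^ 2 < ∏ j, μ (f j) := by
    obtain ⟨i, hi⟩ := h.exists_eq_eigenvalueSeq_one hc h1
    refine ⟨fun _ => i, ?_⟩
    rw [h.lt_minimalError_tensorProblem_iff hc h1 hd hε] at hinit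
    simpa [hi] using hinit
  have hup := log_ncard_lt_prod_le h.nonneg
    (fun i => (h.le_eigenvalueSeq_one hc h1 i).trans hle) hc i₀ hkd (pow_pos hε 2) htriv hnum hne
  rw [← h.absComplexity_tensorProblem hc h1 hd hε] at hup
  set X : ℝ := p.1 ^ (-s) with hX
  have hX1 : 1 ≤ X := Real.one_le_rpow_of_pos_of_le_one_of_nonpos hε hε1 (by linarith)
  have hterm : ∀ l ∈ Finset.range (k p),
      Real.log {i | (p.1 ^ 2) ^ (1 / ((l : ℝ) + 1)) < μ i}.ncard
        ≤ η * X ^ (1 / ((l : ℝ) + 1)) + C := by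
    intro l _
    have h2 := hcount (p.1 ^ (1 / ((l : ℝ) + 1))) (Real.rpow_pos_of_pos hε _)
    rw [Real.rpow_pow_comm hε.le, ← Real.rpow_mul hε.le, mul_comm _ (-s),
      Real.rpow_mul hε.le] at h2
    exact h2
  have hsum := Finset.sum_le_sum hterm
  rw [Finset.sum_add_distrib, ← Finset.mul_sum, Finset.sum_const, Finset.card_range,
    nsmul_eq_mul] at hsum
  have hroots := mul_le_mul_of_nonneg_left (sum_rpow_inv_le hX1 (k p)) hηpos.le
  have hlogk : 1 + Real.log (k p) ≤ w := by
    rcases Nat.eq_zero_or_pos (k p) with h0 | h0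
    · rw [h0, Nat.cast_zero, Real.log_zero]; linarith
    · have := Real.log_le_log (show (0 : ℝ) < k p by exact_mod_cast h0)
        (show (k p : ℝ) ≤ p.2 by exact_mod_cast hkd)
      linarith
  have hcross : 2 * √X * (1 + Real.log (k p)) ≤ X + w ^ 2 := by
    have h2 := mul_le_mul_of_nonneg_left hlogk (show 0 ≤ 2 * √X by positivity)
    have h3 := sq_nonneg (√X - w)
    have h4 := Real.sq_sqrt (show 0 ≤ X by linarith)
    nlinarith
  have hcross' := mul_le_mul_of_nonneg_left hcross hηpos.le
  have hk0 : (0 : ℝ) ≤ k p := Nat.cast_nonneg _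
  have hkw : (k p : ℝ) ≤ k p * w := le_mul_of_one_le_right hk0 hw1
  have hklog : (k p : ℝ) * Real.log p.2 ≤ k p * w :=
    mul_le_mul_of_nonneg_left (by linarith) hk0
  have hXD : X ≤ tractDenom s t p := by
    rw [tractDenom]
    have : 0 ≤ (p.2 : ℝ) ^ t := by positivity
    linarith
  have hXη := mul_le_mul_of_nonneg_left hXD hηpos.le
  have hkη := mul_le_mul_of_nonneg_left hkw hηpos.le
  have hkC := mul_le_mul_of_nonneg_left hkw hC
  nlinarith

/-- For `λ_1 < 1` only dimensions `d = O(ln ε⁻¹)` are admissible. -/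
theorem isWeaklyTractable_of_lt_one (h : DiagonalizedBy S b μ)
    (hc : ∀ x, 0 < x → {i | x < μ i}.Finite) (h1 : 0 < eigenvalueSeq S 1)
    (hlt : eigenvalueSeq S 1 < 1) {s t : ℝ} (hs : 0 < s) (ht : 0 < t) (hdec : LogDecay S s) :
    IsWeaklyTractable (_root_.tensorProblem S) s t := by
  obtain ⟨i₀, -⟩ := h.exists_eq_eigenvalueSeq_one hc h1
  have hlog : 0 < Real.log (eigenvalueSeq S 1)⁻¹ := Real.log_pos ((one_lt_inv₀ h1).2 hlt)
  refine h.isWeaklyTractable_of_logDecay hc h1 hlt.le hs ht hdec i₀ (fun p => p.2)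
    (Eventually.of_forall fun p => ⟨le_rfl, fun hh => absurd hh (lt_irrefl _), fun f _ => ?_⟩)
    (isLittleO_mul_one_add_log_of_le _ hs ht
      (C := 2 / Real.log (eigenvalueSeq S 1)⁻¹) (by positivity) ?_)
  · exact ncard_fin_le _
  · -- `ε` is below the initial error, which decays exponentially in the dimension
    filter_upwards [eventually_absLimit _] with p hp
    have h2 := (h.lt_minimalError_tensorProblem_iff hc h1 hp.2.2.1 hp.1).1 hp.2.2.2
    have h3 := Real.log_le_log (pow_pos hp.1 2) h2.le
    rw [Real.log_pow, Real.log_pow] at h3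
    rw [Real.log_inv] at hlog
    rw [Real.log_inv, Real.log_inv, div_mul_eq_mul_div, le_div_iff₀ hlog]
    push_cast at h3
    linarith

/-- For `λ_1 = 1` simple, tuples with product above `ε ^ 2` have `O(ln ε⁻¹)` coordinates different
from the top index. -/
theorem isWeaklyTractable_of_eq_one_of_simple (h : DiagonalizedBy S b μ)
    (hc : ∀ x, 0 < x → {i | x < μ i}.Finite) (h2 : 0 < eigenvalueSeq S 2)
    (heq : eigenvalueSeq S 1 = 1) (hm : topMultiplicity S = 1) {s t : ℝ} (hs : 0 < s)
    (ht : 0 < t) (hdec : LogDecay S s) : IsWeaklyTractable (_root_.tensorProblem S) s t := by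
  have h1 : 0 < eigenvalueSeq S 1 := by rw [heq]; exact one_pos
  have hle1 : ∀ i, μ i ≤ 1 := fun i => (h.le_eigenvalueSeq_one hc h1 i).trans_eq heq
  obtain ⟨i₀, hi₀⟩ := h.exists_eq_eigenvalueSeq_one hc h1
  rw [h.topMultiplicity_eq hc h1, Set.ncard_eq_one] at hm
  obtain ⟨i', hi'⟩ := hm
  have htriv : ∀ i, i ≠ i₀ → μ i < 1 := by
    intro i hi
    refine lt_of_le_of_ne (hle1 i) fun hh => hi ?_
    have e1 : i ∈ {i | μ i = eigenvalueSeq S 1} := hh.trans heq.symm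
    have e2 : i₀ ∈ {i | μ i = eigenvalueSeq S 1} := hi₀
    rw [hi', Set.mem_singleton_iff] at e1 e2
    rw [e1, e2]
  obtain ⟨i₁, hi₁, hi₁0⟩ := h.exists_ne_pos hc h2 i₀
  -- the largest eigenvalue below `1`
  obtain ⟨i₂, hi₂, hmax⟩ := Set.exists_max_image {i | μ i₁ ≤ μ i ∧ μ i < 1} μ
    ((finite_le hc hi₁0).subset fun i hi => hi.1) ⟨i₁, le_rfl, htriv i₁ hi₁⟩
  have hq : ∀ i, μ i < 1 → μ i ≤ μ i₂ := by
    intro i hi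
    rcases le_total (μ i₁) (μ i) with hh | hh
    · exact hmax i ⟨hh, hi⟩
    · exact hh.trans hi₂.1
  have hlog : 0 < Real.log (μ i₂)⁻¹ :=
    Real.log_pos ((one_lt_inv₀ (hi₁0.trans_le hi₂.1)).2 hi₂.2)
  refine h.isWeaklyTractable_of_logDecay hc h1 heq.le hs ht hdec i₀
    (fun p => min p.2 ⌊2 / Real.log (μ i₂)⁻¹ * Real.log p.1⁻¹⌋₊) ?_
    (isLittleO_mul_one_add_log_of_le _ hs ht (C := 2 / Real.log (μ i₂)⁻¹) (by positivity) ?_)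
  · filter_upwards [eventually_absLimit _] with p hp
    refine ⟨min_le_left _ _, fun _ => htriv, fun f hf => le_min ?_ (Nat.le_floor ?_)⟩
    · exact ncard_fin_le _
    · have h3 := ncard_mul_log_inv_le h.nonneg hle1 hq (pow_pos hp.1 2) hf
      rw [div_mul_eq_mul_div, le_div_iff₀ hlog]
      rw [← inv_pow, Real.log_pow] at h3
      exact_mod_cast h3
  · filter_upwards [eventually_absLimit _] with p hp
    refine (Nat.cast_le.2 (min_le_right _ _)).trans (Nat.floor_le ?_)
    have := Real.log_nonneg ((one_le_inv₀ hp.1).2 hp.2.1)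
    positivity

theorem isWeaklyTractable_of_eq_one (h : DiagonalizedBy S b μ)
    (hc : ∀ x, 0 < x → {i | x < μ i}.Finite) (heq : eigenvalueSeq S 1 = 1) {s t : ℝ} (hs : 0 < s)
    (ht : 1 < t) (hdec : LogDecay S s) : IsWeaklyTractable (_root_.tensorProblem S) s t := by
  have h1 : 0 < eigenvalueSeq S 1 := by rw [heq]; exact one_pos
  obtain ⟨i₀, -⟩ := h.exists_eq_eigenvalueSeq_one hc h1
  refine h.isWeaklyTractable_of_logDecay hc h1 heq.le hs (one_pos.trans ht) hdec i₀
    (fun p => p.2)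
    (Eventually.of_forall fun p => ⟨le_rfl, fun hh => absurd hh (lt_irrefl _), fun f _ => ?_⟩)
    (isLittleO_snd_mul_one_add_log _ hs ht)
  exact ncard_fin_le _

/-! ### Eigenvalues larger than one -/

theorem absComplexity_rescaledOp_rpow (h : DiagonalizedBy S b μ)
    (hc : ∀ x, 0 < x → {i | x < μ i}.Finite) (h1 : 0 < eigenvalueSeq S 1) {ε : ℝ} (hε : 0 < ε)
    (d l : ℕ) :
    absComplexity ((ε / eigenvalueSeq S 1 ^ ((d : ℝ) / 2)) ^ (1 / (l : ℝ))) (rescaledOp S)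
      = {i | (ε ^ 2 / eigenvalueSeq S 1 ^ d) ^ (1 / (l : ℝ)) < μ i / eigenvalueSeq S 1}.ncard := by
  have hpow : 0 < eigenvalueSeq S 1 ^ ((d : ℝ) / 2) := Real.rpow_pos_of_pos h1 _
  rw [h.absComplexity_rescaledOp hc h1 (by positivity), Real.rpow_pow_comm (by positivity),
    div_pow, ← Real.rpow_mul_natCast h1.le]
  have e : (d : ℝ) / 2 * ((2 : ℕ) : ℝ) = d := by push_cast; ring
  rw [e, Real.rpow_natCast]

theorem mul_log_le_maxLogComplexity (S : H →L[𝕜] G) (ε : ℝ) {d l : ℕ} (hl : 1 ≤ l)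
    (hld : l ≤ d) : (l : ℝ) * Real.log
      (absComplexity ((ε / eigenvalueSeq S 1 ^ ((d : ℝ) / 2)) ^ (1 / (l : ℝ))) (rescaledOp S))
      ≤ maxLogComplexity S ε d :=
  le_ciSup (f := fun l : Finset.Icc 1 d => ((l : ℕ) : ℝ) * Real.log
    (absComplexity ((ε / eigenvalueSeq S 1 ^ ((d : ℝ) / 2)) ^ (1 / ((l : ℕ) : ℝ)))
      (rescaledOp S))) (Set.finite_range _).bddAbove ⟨l, Finset.mem_Icc.2 ⟨hl, hld⟩⟩

theorem maxLogComplexity_nonneg (S : H →L[𝕜] G) (ε : ℝ) (d : ℕ) : 0 ≤ maxLogComplexity S ε d :=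
  Real.iSup_nonneg fun _ => mul_nonneg (Nat.cast_nonneg _) (Real.log_natCast_nonneg _)

theorem maxLogComplexity_le (h : DiagonalizedBy S b μ)
    (hc : ∀ x, 0 < x → {i | x < μ i}.Finite) (h1 : 0 < eigenvalueSeq S 1) {d : ℕ} (hd : 1 ≤ d)
    {ε : ℝ} (hε : 0 < ε) (hεd : ε ^ 2 < eigenvalueSeq S 1 ^ d) :
    maxLogComplexity S ε d ≤ Real.log (absComplexity ε (_root_.tensorProblem S d)) := by
  have : Nonempty (Finset.Icc 1 d) := ⟨⟨1, Finset.mem_Icc.2 ⟨le_rfl, hd⟩⟩⟩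
  refine ciSup_le fun l => ?_
  obtain ⟨hl, hld⟩ := Finset.mem_Icc.1 l.2
  rw [h.absComplexity_rescaledOp_rpow hc h1 hε]
  exact h.mul_log_ncard_le_log_absComplexity hc h1 hl hld hε hεd

/-- Upper bound by the univariate quantity: the number of values available for the `l`-th smallest
coordinate is at most `exp (M / l)`, and the harmonic sum costs a factor `1 + ln d`. -/
theorem log_absComplexity_le (h : DiagonalizedBy S b μ)
    (hc : ∀ x, 0 < x → {i | x < μ i}.Finite) (h1 : 0 < eigenvalueSeq S 1) {d : ℕ} (hd : 1 ≤ d)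
    {ε : ℝ} (hε : 0 < ε) (hεd : ε ^ 2 < eigenvalueSeq S 1 ^ d) :
    Real.log (absComplexity ε (_root_.tensorProblem S d))
      ≤ d * Real.log d + maxLogComplexity S ε d * (1 + Real.log d) := by
  obtain ⟨i₀, hi₀⟩ := h.exists_eq_eigenvalueSeq_one hc h1
  have hpos : 0 < ε ^ 2 / eigenvalueSeq S 1 ^ d := by positivity
  have hup := log_ncard_lt_prod_le (a := fun i => μ i / eigenvalueSeq S 1)
    (fun i => div_nonneg (h.nonneg i) h1.le)
    (fun i => div_le_one_of_le₀ (h.le_eigenvalueSeq_one hc h1 i) h1.le)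
    (finite_lt_div hc h1) i₀ (le_refl d) hpos (fun hh => absurd hh (lt_irrefl _))
    (fun f _ => ncard_fin_le _)
    ⟨fun _ => i₀, by simpa [hi₀, div_self h1.ne'] using (div_lt_one (pow_pos h1 d)).2 hεd⟩
  rw [h.absComplexity_tensorProblem hc h1 hd hε, setOf_lt_prod_eq h1]
  refine hup.trans (add_le_add_right ?_ _)
  refine le_trans (Finset.sum_le_sum fun l hl => ?_)
    (((Finset.mul_sum _ _ _).symm.le).trans (mul_le_mul_of_nonneg_left (sum_inv_range_le d)
      (maxLogComplexity_nonneg S ε d)))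
  have h2 := mul_log_le_maxLogComplexity S ε (Nat.succ_pos l) (Finset.mem_range.1 hl)
  rw [h.absComplexity_rescaledOp_rpow hc h1 hε] at h2
  push_cast at h2
  rw [← div_eq_mul_inv, le_div_iff₀ (by positivity), mul_comm]
  exact h2

theorem one_lt_of_isWeaklyTractable_of_one_lt (h : DiagonalizedBy S b μ)
    (hc : ∀ x, 0 < x → {i | x < μ i}.Finite) (h2 : 0 < eigenvalueSeq S 2)
    (hgt : 1 < eigenvalueSeq S 1) {s t : ℝ}
    (hwt : IsWeaklyTractable (_root_.tensorProblem S) s t) : 1 < t := by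
  have h1 : 0 < eigenvalueSeq S 1 := one_pos.trans hgt
  obtain ⟨i₀, hi₀⟩ := h.exists_eq_eigenvalueSeq_one hc h1
  obtain ⟨i₁, hne, hi₁⟩ := h.exists_ne_pos hc h2 i₀
  -- `q` top eigenvalues compensate for one factor `μ i₁`
  obtain ⟨q, hq⟩ := pow_unbounded_of_one_lt (eigenvalueSeq S 1 / μ i₁) hgt
  have hq1 : eigenvalueSeq S 1 / μ i₁ < eigenvalueSeq S 1 ^ (q + 1) :=
    hq.trans (pow_lt_pow_right₀ hgt q.lt_succ_self)
  refine one_lt_of_isWeaklyTractable hwt one_pos le_rfl q.succ_pos fun k hk => ?_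
  have hd : 1 ≤ (q + 1) * k := Nat.mul_pos q.succ_pos hk
  have hεd : (1 : ℝ) ^ 2 < eigenvalueSeq S 1 ^ ((q + 1) * k) := by
    rw [one_pow]; exact one_lt_pow₀ hgt (by omega)
  refine ⟨(h.lt_minimalError_tensorProblem_iff hc h1 hd one_pos).2 hεd, ?_⟩
  refine le_trans ?_ (h.mul_log_ncard_le_log_absComplexity hc h1 hk
    (Nat.le_mul_of_pos_left k q.succ_pos) one_pos hεd)
  refine mul_le_mul_of_nonneg_left (Real.log_le_log two_pos ?_) (Nat.cast_nonneg _)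
  have hroot : ((1 : ℝ) ^ 2 / eigenvalueSeq S 1 ^ ((q + 1) * k)) ^ (1 / (k : ℝ))
      = (eigenvalueSeq S 1 ^ (q + 1))⁻¹ := by
    rw [one_pow, one_div, pow_mul, ← inv_pow, one_div,
      Real.pow_rpow_inv_natCast (by positivity) (by omega)]
  have hsub : ({i₀, i₁} : Set ι) ⊆ {i | ((1 : ℝ) ^ 2 / eigenvalueSeq S 1 ^ ((q + 1) * k)) ^
      (1 / (k : ℝ)) < μ i / eigenvalueSeq S 1} := by
    rw [hroot]
    rintro i (rfl | rfl)
    · show _ < μ i / _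
      rw [hi₀, div_self h1.ne']
      exact inv_lt_one_of_one_lt₀ (one_lt_pow₀ hgt q.succ_ne_zero)
    · show _ < μ i / _
      rw [inv_lt_comm₀ (pow_pos h1 _) (div_pos hi₁ h1), inv_div]
      exact hq1
  have hcard := Set.ncard_le_ncard hsub (finite_lt_div hc h1 _ (by positivity))
  rw [Set.ncard_pair hne.symm] at hcard
  exact_mod_cast hcard

theorem one_lt_of_isWeaklyTractable_of_multiple (h : DiagonalizedBy S b μ)
    (hc : ∀ x, 0 < x → {i | x < μ i}.Finite) (heq : eigenvalueSeq S 1 = 1)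
    (hm : 1 < topMultiplicity S) {s t : ℝ}
    (hwt : IsWeaklyTractable (_root_.tensorProblem S) s t) : 1 < t := by
  have h1 : 0 < eigenvalueSeq S 1 := by rw [heq]; exact one_pos
  rw [h.topMultiplicity_eq hc h1] at hm
  refine one_lt_of_isWeaklyTractable hwt (ε := 1 / 2) (by norm_num) (by norm_num) le_rfl
    fun k hk => ?_
  rw [one_mul]
  have hεd : (1 / 2 : ℝ) ^ 2 < eigenvalueSeq S 1 ^ k := by rw [heq, one_pow]; norm_num
  refine ⟨(h.lt_minimalError_tensorProblem_iff hc h1 hk (by norm_num)).2 hεd, ?_⟩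
  refine le_trans ?_ (h.mul_log_ncard_le_log_absComplexity hc h1 hk le_rfl (by norm_num) hεd)
  refine mul_le_mul_of_nonneg_left (Real.log_le_log two_pos ?_) (Nat.cast_nonneg _)
  have hsub : {i | μ i = eigenvalueSeq S 1} ⊆ {i | ((1 / 2 : ℝ) ^ 2 / eigenvalueSeq S 1 ^ k) ^
      (1 / (k : ℝ)) < μ i / eigenvalueSeq S 1} := by
    intro i (hi : μ i = eigenvalueSeq S 1)
    show _ < μ i / _
    rw [hi, div_self h1.ne']
    exact Real.rpow_lt_one (by positivity) ((div_lt_one (pow_pos h1 _)).2 hεd) (by positivity)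
  have hcard := hm.trans_le (Set.ncard_le_ncard hsub (finite_lt_div hc h1 _ (by positivity)))
  exact_mod_cast hcard

theorem isLittleO_maxLogComplexity (h : DiagonalizedBy S b μ)
    (hc : ∀ x, 0 < x → {i | x < μ i}.Finite) (h1 : 0 < eigenvalueSeq S 1) {s t : ℝ}
    (hwt : IsWeaklyTractable (_root_.tensorProblem S) s t) :
    (fun p : ℝ × ℕ => maxLogComplexity S p.1 p.2)
      =o[absLimit (_root_.tensorProblem S)] tractDenom s t := by
  refine isLittleO_of_le _ ((isWeaklyTractable_iff _).1 hwt) ?_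
  filter_upwards [eventually_absLimit _] with p hp
  exact ⟨maxLogComplexity_nonneg _ _ _, h.maxLogComplexity_le hc h1 hp.2.2.1 hp.1
    ((h.lt_minimalError_tensorProblem_iff hc h1 hp.2.2.1 hp.1).1 hp.2.2.2)⟩

/-- For `λ_1 > 1` the rescaled accuracy decreases with the dimension. -/
theorem maxLogComplexity_one_le (h : DiagonalizedBy S b μ)
    (hc : ∀ x, 0 < x → {i | x < μ i}.Finite) (hgt : 1 < eigenvalueSeq S 1) {ε : ℝ}
    (hε : 0 < ε) : maxLogComplexity S ε 1 ≤ maxLogComplexity S ε 2 := by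
  have h1 : 0 < eigenvalueSeq S 1 := one_pos.trans hgt
  have : Nonempty (Finset.Icc 1 1) := ⟨⟨1, Finset.mem_Icc.2 ⟨le_rfl, le_rfl⟩⟩⟩
  refine ciSup_le fun ⟨l, hl⟩ => ?_
  obtain rfl : l = 1 := by rw [Finset.mem_Icc] at hl; omega
  refine le_trans ?_ (mul_log_le_maxLogComplexity S ε le_rfl one_le_two)
  rw [h.absComplexity_rescaledOp_rpow hc h1 hε, h.absComplexity_rescaledOp_rpow hc h1 hε]
  simp only [Nat.cast_one, div_one, Real.rpow_one, one_mul, pow_one]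
  have hlt : ε ^ 2 / eigenvalueSeq S 1 ^ 2 ≤ ε ^ 2 / eigenvalueSeq S 1 :=
    div_le_div_of_nonneg_left (by positivity) h1 (by nlinarith)
  have hcard := Set.ncard_le_ncard
    (fun i (hi : ε ^ 2 / eigenvalueSeq S 1 < μ i / eigenvalueSeq S 1) => hlt.trans_lt hi)
    (finite_lt_div hc h1 (ε ^ 2 / eigenvalueSeq S 1 ^ 2) (by positivity))
  rcases Nat.eq_zero_or_pos
    {i | ε ^ 2 / eigenvalueSeq S 1 < μ i / eigenvalueSeq S 1}.ncard with h0 | h0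
  · rw [h0, Nat.cast_zero, Real.log_zero]; exact Real.log_natCast_nonneg _
  · exact Real.log_le_log (by exact_mod_cast h0) (by exact_mod_cast hcard)

/-- The weight `ln d` vanishes for `d = 1`. There the quantity is controlled by its value at
`d = 2`, which is admissible for the same `ε` because the initial error increases with `d`. -/
theorem isLittleO_maxLogComplexity_of_log_mul (h : DiagonalizedBy S b μ)
    (hc : ∀ x, 0 < x → {i | x < μ i}.Finite) (hgt : 1 < eigenvalueSeq S 1) {s t : ℝ}
    (ht : 0 < t)
    (hM : (fun p : ℝ × ℕ => Real.log p.2 * maxLogComplexity S p.1 p.2)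
      =o[absLimit (_root_.tensorProblem S)] tractDenom s t) :
    (fun p : ℝ × ℕ => maxLogComplexity S p.1 p.2)
      =o[absLimit (_root_.tensorProblem S)] tractDenom s t := by
  have h1 : 0 < eigenvalueSeq S 1 := one_pos.trans hgt
  have hlog2 : 0 < Real.log 2 := Real.log_pos one_lt_two
  let τ : ℝ × ℕ → ℝ × ℕ := fun p => (p.1, max p.2 2)
  have hτ : Tendsto τ (absLimit (_root_.tensorProblem S))
      (absLimit (_root_.tensorProblem S)) := by
    refine tendsto_to_absLimit _ (tendsto_atTop_mono (fun p => ?_) (tendsto_absLimit _)) ?_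
    · simp [τ]
    · filter_upwards [eventually_absLimit _] with p hp
      have hd : 1 ≤ max p.2 2 := one_le_two.trans (le_max_right _ _)
      refine ⟨hp.1, hp.2.1, hd, (h.lt_minimalError_tensorProblem_iff hc h1 hd hp.1).2 ?_⟩
      exact ((h.lt_minimalError_tensorProblem_iff hc h1 hp.2.2.1 hp.1).1 hp.2.2.2).trans_le
        (pow_le_pow_right₀ hgt.le (le_max_left _ _))
  have hden : (tractDenom s t ∘ τ) =O[absLimit (_root_.tensorProblem S)] tractDenom s t := by
    refine IsBigO.of_bound (2 ^ t) ?_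
    filter_upwards [eventually_absLimit _] with p hp
    have hd1 : 1 ≤ p.2 := hp.2.2.1
    have hd2 : 1 ≤ (τ p).2 := one_le_two.trans (le_max_right _ _)
    rw [Function.comp_apply, Real.norm_of_nonneg (tractDenom_pos (p := τ p) hp.1 hd2).le,
      Real.norm_of_nonneg (tractDenom_pos hp.1 hd1).le]
    have h2 : (((τ p).2 : ℕ) : ℝ) ≤ 2 * p.2 := by
      exact_mod_cast (show max p.2 2 ≤ 2 * p.2 by omega)
    have h3 := Real.rpow_le_rpow (Nat.cast_nonneg _) h2 ht.le
    rw [Real.mul_rpow zero_le_two (Nat.cast_nonneg _)] at h3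
    have h4 : 1 ≤ (2 : ℝ) ^ t := Real.one_le_rpow one_le_two ht.le
    have h5 : 0 < p.1 ^ (-s) := Real.rpow_pos_of_pos hp.1 _
    have h6 : tractDenom s t (τ p) = p.1 ^ (-s) + ((τ p).2 : ℝ) ^ t := rfl
    rw [h6, tractDenom]
    nlinarith
  have hlim := ((hM.comp_tendsto hτ).trans_isBigO hden).const_mul_left (Real.log 2)⁻¹
  refine isLittleO_of_le _ hlim ?_
  filter_upwards [eventually_absLimit _] with p hp
  refine ⟨maxLogComplexity_nonneg _ _ _, ?_⟩
  have hmono : maxLogComplexity S p.1 p.2 ≤ maxLogComplexity S p.1 (max p.2 2) := by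
    rcases hp.2.2.1.eq_or_lt with hd | hd
    · rw [← hd]
      exact h.maxLogComplexity_one_le hc hgt hp.1
    · rw [max_eq_left hd]
  have hlog : Real.log 2 ≤ Real.log ((max p.2 2 : ℕ) : ℝ) :=
    Real.log_le_log two_pos (by exact_mod_cast le_max_right _ _)
  show _ ≤ (Real.log 2)⁻¹ * (Real.log ((max p.2 2 : ℕ) : ℝ) * maxLogComplexity S p.1 (max p.2 2))
  rw [le_inv_mul_iff₀ hlog2]
  exact mul_le_mul hlog hmono (maxLogComplexity_nonneg _ _ _) (hlog2.le.trans hlog)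

theorem isWeaklyTractable_of_one_lt (h : DiagonalizedBy S b μ)
    (hc : ∀ x, 0 < x → {i | x < μ i}.Finite) (hgt : 1 < eigenvalueSeq S 1) {s t : ℝ}
    (hs : 0 < s) (ht : 1 < t)
    (hM : (fun p : ℝ × ℕ => Real.log p.2 * maxLogComplexity S p.1 p.2)
      =o[absLimit (_root_.tensorProblem S)] tractDenom s t) :
    IsWeaklyTractable (_root_.tensorProblem S) s t := by
  have h1 : 0 < eigenvalueSeq S 1 := one_pos.trans hgt
  have hM' := h.isLittleO_maxLogComplexity_of_log_mul hc hgt (one_pos.trans ht) hM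
  refine (isWeaklyTractable_iff _).2 (isLittleO_of_le _
    (((isLittleO_snd_mul_one_add_log _ hs ht).add hM').add hM) ?_)
  filter_upwards [eventually_absLimit _] with p hp
  refine ⟨Real.log_natCast_nonneg _, (h.log_absComplexity_le hc h1 hp.2.2.1 hp.1
    ((h.lt_minimalError_tensorProblem_iff hc h1 hp.2.2.1 hp.1).1 hp.2.2.2)).trans ?_⟩
  have : (0 : ℝ) ≤ p.2 := Nat.cast_nonneg _
  nlinarith

end DiagonalizedBy

end Problem

theorem mainTheorem3 {𝕜 : Type u} [RCLike 𝕜]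
    {H : Type v} [NormedAddCommGroup H] [InnerProductSpace 𝕜 H] [CompleteSpace H]
    {G : Type w} [NormedAddCommGroup G] [InnerProductSpace 𝕜 G] [CompleteSpace G]
    (S : H →L[𝕜] G) (hS : IsCompactOperator S) (hS₂ : 0 < eigenvalueSeq S 2)
    (s t : ℝ) (hs : 0 < s) (ht : 0 < t) :
    (eigenvalueSeq S 1 < 1 →
      (IsWeaklyTractable (tensorProblem S) s t ↔ LogDecay S s)) ∧
    (eigenvalueSeq S 1 = 1 → topMultiplicity S = 1 →
      (IsWeaklyTractable (tensorProblem S) s t ↔ LogDecay S s)) ∧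
    (eigenvalueSeq S 1 = 1 → 1 < topMultiplicity S →
      (IsWeaklyTractable (tensorProblem S) s t ↔ 1 < t ∧ LogDecay S s)) ∧
    (1 < eigenvalueSeq S 1 →
      (IsWeaklyTractable (tensorProblem S) s t →
        1 < t ∧ Tendsto (fun p : ℝ × ℕ =>
            maxLogComplexity S p.1 p.2 / (p.1 ^ (-s) + (p.2 : ℝ) ^ t))
          (absLimit (tensorProblem S)) (𝓝 0)) ∧
      (1 < t ∧ Tendsto (fun p : ℝ × ℕ =>
            Real.log p.2 * maxLogComplexity S p.1 p.2 / (p.1 ^ (-s) + (p.2 : ℝ) ^ t))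
          (absLimit (tensorProblem S)) (𝓝 0) →
        IsWeaklyTractable (tensorProblem S) s t)) := by
  obtain ⟨ι, b, μ, h⟩ := exists_diagonalizedBy S hS
  have hc : ∀ x, 0 < x → {i | x < μ i}.Finite := fun x hx => h.finite_lt_of_isCompactOperator hS hx
  have h1 := h.eigenvalueSeq_one_pos hc hS₂
  refine ⟨fun hlt => ⟨fun hwt => h.logDecay_of_isWeaklyTractable hc h1 hs hwt,
      fun hdec => h.isWeaklyTractable_of_lt_one hc h1 hlt hs ht hdec⟩,
    fun heq hm => ⟨fun hwt => h.logDecay_of_isWeaklyTractable hc h1 hs hwt,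
      fun hdec => h.isWeaklyTractable_of_eq_one_of_simple hc hS₂ heq hm hs ht hdec⟩,
    fun heq hm => ⟨fun hwt => ⟨h.one_lt_of_isWeaklyTractable_of_multiple hc heq hm hwt,
        h.logDecay_of_isWeaklyTractable hc h1 hs hwt⟩,
      fun hdec => h.isWeaklyTractable_of_eq_one hc heq hs hdec.1 hdec.2⟩,
    fun hgt => ⟨fun hwt => ⟨h.one_lt_of_isWeaklyTractable_of_one_lt hc hS₂ hgt hwt, ?_⟩,
      fun hM => h.isWeaklyTractable_of_one_lt hc hgt hs hM.1 ?_⟩⟩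
  · exact (tendsto_div_tractDenom_iff _).2 (h.isLittleO_maxLogComplexity hc h1 hwt)
  · exact (tendsto_div_tractDenom_iff _).1 hM.2
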